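/- Let $X$ be a set. All $F$-inverse monoids are considered in the signature $(\cdot,1,{}^{-1},{}^{\mathfrak m})$, where $s^{\mathfrak m}$ is the greatest element of the $\sigma$-class of $s$ in the natural partial order and $\sigma$ is the minimum group congruence ($s\mathrel\sigma t$ iff $s,t$ have a common lower bound). "$X$-generated" refers to this signature (for groups, ${}^{\mathfrak m}$ is the identity), and a map between $X$-generated structures is canonical if it respects the generators. A term is a formal expression $w=u_0v_1^{\mathfrak m}u_1\cdots v_n^{\mathfrak m}u_n$ with $u_i,v_i$ words over $X\cup X^{-1}$; $w_S$ is its value in $S$. For an $X$-generated group $G$, the Cayley graph $\Gamma_X$ has vertex set $G$ and an edge labeled $a$ from $g$ to $ga_G$ for all $g\in G$, $a\in X\cup X^{-1}$; the inverse of this edge is the edge labeled $a^{-1}$ from $ga_G$ to $g$. $\operatorname{Sub}\Gamma_X$ is the lattice of subgraphs (sets of vertices and edges closed under end vertices and inverse edges, including the empty subgraph $\emptyset$), on which $G$ acts by left translation. A term $w$ as above labels the journey starting at $g$ that alternately traverses the paths labeled $u_i$ and jumps from the current vertex $h$ to $h(v_{i+1})_G$; it ends at $gw_G$. Denote by $\langle\overline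 w\rangle$ the subgraph spanned by its paths when $g=1$. A closure operator $c$ on $(\operatorname{Sub}\Gamma_X,\subseteq)$ is $G$-invariant if $(g\Delta)^c=g(\Delta^c)$ for all $g\in G$ and all subgraphs $\Delta$, and finitary if $\Delta^c=\bigcup\{F^c: F\subseteq\Delta\text{ finite}\}$ for all $\Delta$; a subgraph is compact if it is the closure of a finite subgraph. For an $X$-generated $F$-inverse monoid $S$ with greatest group image $G=S/\sigma$, let $c_S$ be the ($G$-invariant) closure operator on $\operatorname{Sub}\Gamma_X$ for which $\Delta$ is closed iff for all terms $u,v$ with $u_S=v_S$ and all vertices $g,h$ of $\Delta$, $u$ labels a journey from $g$ to $h$ in $\Delta$ iff $v$ does. Put $F\Gamma(w)=\langle\overline w\rangle^{c_S}$ for a term $w$, and $F\Gamma(s)=F\Gamma(w)$ for any term $w$ with $w_S=s$. For a $G$-invariant closure operator $c$ on $\operatorname{Sub}\Gamma_X$, let $S_c$ be the $F$-inverse monoid of all pairs $(\Delta,g)$ with $g\in G$ and $\Delta$ a compact subgraph containing $1$ and $g$, with operations $(\Delta,g)(\Xi,h)=((\Delta\cup g\Xi)^c,gh)$, $(\Delta,g)^{-1}=(g^{-1}\Delta,g^{-1})$,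 $(\Delta,g)^{\mathfrak m}=(\{1,g\}^c,g)$, identity $(\{1\}^c,1)$ and generators $x\mapsto(\langle\overline x\rangle^c,x_G)$. **Proposition.** 1. For every $X$-generated $F$-inverse monoid $S$ with greatest group image $G$, $F\Gamma(s)$ is well defined, and the map $\psi\colon S\to S_{c_S}$, $s\mapsto(F\Gamma(s),s\sigma)$ is a canonical isomorphism of $F$-inverse monoids. 2. For every $X$-generated group $G$ and every $G$-invariant, finitary closure operator $c$ on $(\operatorname{Sub}\Gamma_X,\subseteq)$, $S_c$ is an $X$-generated $F$-inverse monoid with greatest group image $G$ via $(\Delta,g)\mapsto g$, and $\Delta^c=\Delta^{c_{S_c}}$ for every non-empty subgraph $\Delta$ of $\Gamma_X$. Moreover, if $\emptyset^c=\emptyset$, then $c=c_{S_c}$. -/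

import Mathlib

universe u v w

namespace FInv

/-! ### Inverse monoids and `F`-inverse monoids -/

/-- Inverse monoids: monoids in which every element `a` has a unique inverse `a⁻¹`
in the sense of semigroup theory. -/
class InverseMonoid (S : Type v) extends Monoid S, Inv S where
  mul_inv_mul : ∀ a : S, a * a⁻¹ * a = a
  inv_mul_inv : ∀ a : S, a⁻¹ * a * a⁻¹ = a⁻¹
  inv_unique : ∀ a b : S, a * b * a = a → b * a * b = b → b = a⁻¹

/-- The natural partial order of an inverse monoid. -/
def NatLE {S : Type v} [InverseMonoid S] (a b : S) : Prop := a = a * a⁻¹ * b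

/-- The relation `σ` on an inverse monoid (the minimum group congruence): two elements are related
if and only if they have a common lower bound in the natural partial order. -/
def SigmaRel {S : Type v} [InverseMonoid S] (a b : S) : Prop := ∃ r : S, NatLE r a ∧ NatLE r b

/-- `F`-inverse monoids in the extended signature: `mx s` (written `s^𝔪`) is the greatest element
of the `σ`-class of `s` in the natural partial order. -/
class FInverseMonoid (S : Type v) extends InverseMonoid S where
  mx : S → S
  sigma_mx : ∀ s : S, SigmaRel s (mx s)
  le_mx : ∀ s t : S, SigmaRel s t → NatLE t (mx s)

/-- `S` is generated by `ι(X)` as an `F`-inverse monoid: the only subset of `S` that contains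
`ι(X)` and is closed under `1`, multiplication, inversion and `(·)^𝔪` is `S` itself. -/
def Generates {X : Type u} {S : Type v} [FInverseMonoid S] (ι : X → S) : Prop :=
  ∀ T : Set S, (∀ x, ι x ∈ T) → 1 ∈ T → (∀ a ∈ T, ∀ b ∈ T, a * b ∈ T) → (∀ a ∈ T, a⁻¹ ∈ T) →
    (∀ a ∈ T, FInverseMonoid.mx a ∈ T) → ∀ s, s ∈ T

/-- `π` exhibits the group `G` as the greatest group image `S/σ` of `S`. -/
def IsGreatestGroupImage {S : Type v} [InverseMonoid S] {G : Type w} [Group G] (π : S →* G) :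
    Prop :=
  Function.Surjective π ∧ ∀ s t : S, π s = π t ↔ SigmaRel s t

/-! ### Words and terms -/

/-- Words over `X ∪ X⁻¹`; the letter `(x, true)` is `x` and `(x, false)` is `x⁻¹`. -/
abbrev Word (X : Type u) := List (X × Bool)

/-- The formal expressions `u₀ v₁^𝔪 u₁ ⋯ vₙ^𝔪 uₙ` with `uᵢ`, `vᵢ` words over `X ∪ X⁻¹`:
`word u` is the expression `u`, and `jump u v t` is the expression `u v^𝔪 t`. -/
inductive FTerm (X : Type u) : Type u
  | word (a : Word X) : FTerm X
  | jump (a b : Word X) (t : FTerm X) : FTerm X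

/-- The value of a letter under an assignment of the generators. -/
def letter {X : Type u} {M : Type v} [Inv M] (ι : X → M) (a : X × Bool) : M :=
  if a.2 then ι a.1 else (ι a.1)⁻¹

/-- The value of a word under an assignment of the generators. -/
def wordVal {X : Type u} {M : Type v} [Monoid M] [Inv M] (ι : X → M) : Word X → M
  | [] => 1
  | a :: p => letter ι a * wordVal ι p

/-- The value `w_S` of a term `w` in an `F`-inverse monoid `S`. -/
def FTerm.val {X : Type u} {S : Type v} [FInverseMonoid S] (ι : X → S) : FTerm X → S
  | .word a => wordVal ι a
  | .jump a b t => wordVal ι a * FInverseMonoid.mx (wordVal ι b) * t.val ι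

/-- The value `w_G` of a term `w` in a group `G`, where `(·)^𝔪` is the identity map. -/
def FTerm.groupVal {X : Type u} {G : Type w} [Group G] (ι : X → G) : FTerm X → G
  | .word a => wordVal ι a
  | .jump a b t => wordVal ι a * wordVal ι b * t.groupVal ι

/-! ### The Cayley graph and its subgraphs

The Cayley graph of a group `G` with respect to `ι : X → G` has vertex set `G` and one edge
`(g, a)` from `g` to `g a_G` for each vertex `g` and each letter `a` of `X ∪ X⁻¹`. -/

/-- The edges of the Cayley graph: pairs (initial vertex, label). -/
abbrev Edge (X : Type u) (G : Type w) := G × (X × Bool)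

/-- The terminal vertex of an edge. -/
def Edge.tgt {X : Type u} {G : Type w} [Group G] (ι : X → G) (e : Edge X G) : G :=
  e.1 * letter ι e.2

/-- The inverse of an edge. -/
def Edge.rev {X : Type u} {G : Type w} [Group G] (ι : X → G) (e : Edge X G) : Edge X G :=
  (Edge.tgt ι e, (e.2.1, !e.2.2))

theorem letter_not {X : Type u} {G : Type w} [Group G] (ι : X → G) (a : X × Bool) :
    letter ι (a.1, !a.2) = (letter ι a)⁻¹ := by
  obtain ⟨x, b⟩ := a
  cases b <;> simp [letter]

theorem Edge.tgt_rev {X : Type u} {G : Type w} [Group G] (ι : X → G) (e : Edge X G) :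
    Edge.tgt ι (Edge.rev ι e) = e.1 := by
  simp [Edge.tgt, Edge.rev, letter_not]

theorem Edge.rev_rev {X : Type u} {G : Type w} [Group G] (ι : X → G) (e : Edge X G) :
    Edge.rev ι (Edge.rev ι e) = e := by
  refine Prod.ext (Edge.tgt_rev ι e) ?_
  simp [Edge.rev]

/-- Subgraphs of the Cayley graph: sets of vertices and edges closed under taking initial
vertices, terminal vertices and inverse edges. The empty subgraph is included. -/
@[ext]
structure Subgr {X : Type u} {G : Type w} [Group G] (ι : X → G) where
  verts : Set G
  edges : Set (Edge X G)
  src_mem : ∀ e ∈ edges, e.1 ∈ verts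
  tgt_mem : ∀ e ∈ edges, Edge.tgt ι e ∈ verts
  rev_mem : ∀ e ∈ edges, Edge.rev ι e ∈ edges

section Subgraphs

variable {X : Type u} {G : Type w} [Group G] {ι : X → G}

/-- Subgraphs are ordered by inclusion. -/
instance : PartialOrder (Subgr ι) where
  le Δ Ξ := Δ.verts ⊆ Ξ.verts ∧ Δ.edges ⊆ Ξ.edges
  le_refl _ := ⟨subset_rfl, subset_rfl⟩
  le_trans _ _ _ h k := ⟨h.1.trans k.1, h.2.trans k.2⟩
  le_antisymm _ _ h k := Subgr.ext (h.1.antisymm k.1) (h.2.antisymm k.2)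

/-- Subgraphs form a complete lattice under union and intersection. -/
instance : CompleteLattice (Subgr ι) where
  sup Δ Ξ :=
    { verts := Δ.verts ∪ Ξ.verts
      edges := Δ.edges ∪ Ξ.edges
      src_mem := fun e h => h.imp (Δ.src_mem e) (Ξ.src_mem e)
      tgt_mem := fun e h => h.imp (Δ.tgt_mem e) (Ξ.tgt_mem e)
      rev_mem := fun e h => h.imp (Δ.rev_mem e) (Ξ.rev_mem e) }
  inf Δ Ξ :=
    { verts := Δ.verts ∩ Ξ.verts
      edges := Δ.edges ∩ Ξ.edges
      src_mem := fun e h => ⟨Δ.src_mem e h.1, Ξ.src_mem e h.2⟩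
      tgt_mem := fun e h => ⟨Δ.tgt_mem e h.1, Ξ.tgt_mem e h.2⟩
      rev_mem := fun e h => ⟨Δ.rev_mem e h.1, Ξ.rev_mem e h.2⟩ }
  sSup A :=
    { verts := {g | ∃ Δ ∈ A, g ∈ Δ.verts}
      edges := {e | ∃ Δ ∈ A, e ∈ Δ.edges}
      src_mem := fun e ⟨Δ, hA, h⟩ => ⟨Δ, hA, Δ.src_mem e h⟩
      tgt_mem := fun e ⟨Δ, hA, h⟩ => ⟨Δ, hA, Δ.tgt_mem e h⟩
      rev_mem := fun e ⟨Δ, hA, h⟩ => ⟨Δ, hA, Δ.rev_mem e h⟩ }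
  sInf A :=
    { verts := {g | ∀ Δ ∈ A, g ∈ Δ.verts}
      edges := {e | ∀ Δ ∈ A, e ∈ Δ.edges}
      src_mem := fun e h Δ hA => Δ.src_mem e (h Δ hA)
      tgt_mem := fun e h Δ hA => Δ.tgt_mem e (h Δ hA)
      rev_mem := fun e h Δ hA => Δ.rev_mem e (h Δ hA) }
  top := ⟨Set.univ, Set.univ, fun _ _ => trivial, fun _ _ => trivial, fun _ _ => trivial⟩
  bot := ⟨∅, ∅, fun _ h => h.elim, fun _ h => h.elim, fun _ h => h.elim⟩
  le_sup_left _ _ := ⟨Set.subset_union_left, Set.subset_union_left⟩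
  le_sup_right _ _ := ⟨Set.subset_union_right, Set.subset_union_right⟩
  sup_le _ _ _ h k := ⟨Set.union_subset h.1 k.1, Set.union_subset h.2 k.2⟩
  inf_le_left _ _ := ⟨Set.inter_subset_left, Set.inter_subset_left⟩
  inf_le_right _ _ := ⟨Set.inter_subset_right, Set.inter_subset_right⟩
  le_inf _ _ _ h k := ⟨Set.subset_inter h.1 k.1, Set.subset_inter h.2 k.2⟩
  isLUB_sSup _ :=
    ⟨fun Δ hA => ⟨fun _ h => ⟨Δ, hA, h⟩, fun _ h => ⟨Δ, hA, h⟩⟩,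
      fun _ hb => ⟨fun _ ⟨_, hA, h⟩ => (hb hA).1 h, fun _ ⟨_, hA, h⟩ => (hb hA).2 h⟩⟩
  isGLB_sInf _ :=
    ⟨fun Δ hA => ⟨fun _ h => h Δ hA, fun _ h => h Δ hA⟩,
      fun _ hb => ⟨fun _ h _ hA => (hb hA).1 h, fun _ h _ hA => (hb hA).2 h⟩⟩
  le_top _ := ⟨fun _ _ => trivial, fun _ _ => trivial⟩
  bot_le _ := ⟨fun _ h => h.elim, fun _ h => h.elim⟩

/-- A subgraph is finite if it has finitely many vertices and edges. -/
def Subgr.IsFinite (Δ : Subgr ι) : Prop := Δ.verts.Finite ∧ Δ.edges.Finite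

/-- The left action of `G` on the subgraphs of its Cayley graph:
`g Δ` has vertices `g h` with `h` in `Δ` and edges `(g h, a)` with `(h, a)` in `Δ`. -/
instance : MulAction G (Subgr ι) where
  smul g Δ :=
    { verts := {h | g⁻¹ * h ∈ Δ.verts}
      edges := {e | (g⁻¹ * e.1, e.2) ∈ Δ.edges}
      src_mem := fun _ h => Δ.src_mem _ h
      tgt_mem := fun e h => by
        have := Δ.tgt_mem _ h
        simpa [Edge.tgt, mul_assoc] using this
      rev_mem := fun e h => by
        have := Δ.rev_mem _ h
        simpa [Edge.rev, Edge.tgt, mul_assoc] using this }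
  one_smul Δ := by
    refine Subgr.ext (Set.ext fun h => ?_) (Set.ext fun e => ?_)
    · change 1⁻¹ * h ∈ Δ.verts ↔ _
      simp
    · change (1⁻¹ * e.1, e.2) ∈ Δ.edges ↔ _
      simp
  mul_smul g k Δ := by
    refine Subgr.ext (Set.ext fun h => ?_) (Set.ext fun e => ?_)
    · change (g * k)⁻¹ * h ∈ Δ.verts ↔ k⁻¹ * (g⁻¹ * h) ∈ Δ.verts
      simp [mul_assoc]
    · change ((g * k)⁻¹ * e.1, e.2) ∈ Δ.edges ↔ (k⁻¹ * (g⁻¹ * e.1), e.2) ∈ Δ.edges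
      simp [mul_assoc]

theorem Subgr.mem_verts_smul {g h : G} {Δ : Subgr ι} : h ∈ (g • Δ).verts ↔ g⁻¹ * h ∈ Δ.verts :=
  Iff.rfl

theorem Subgr.mem_edges_smul {g : G} {e : Edge X G} {Δ : Subgr ι} :
    e ∈ (g • Δ).edges ↔ (g⁻¹ * e.1, e.2) ∈ Δ.edges :=
  Iff.rfl

theorem Subgr.smul_mono (g : G) {Δ Ξ : Subgr ι} (h : Δ ≤ Ξ) : g • Δ ≤ g • Ξ :=
  ⟨fun _ k => h.1 k, fun _ k => h.2 k⟩

theorem Subgr.smul_le_iff {g : G} {Δ Ξ : Subgr ι} : g • Δ ≤ Ξ ↔ Δ ≤ g⁻¹ • Ξ := by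
  constructor
  · intro h
    simpa using Subgr.smul_mono g⁻¹ h
  · intro h
    simpa using Subgr.smul_mono g h

theorem Subgr.smul_sup (g : G) (Δ Ξ : Subgr ι) : g • (Δ ⊔ Ξ) = g • Δ ⊔ g • Ξ := rfl

theorem Subgr.IsFinite.sup {Δ Ξ : Subgr ι} (h : Δ.IsFinite) (k : Ξ.IsFinite) : (Δ ⊔ Ξ).IsFinite :=
  ⟨h.1.union k.1, h.2.union k.2⟩

theorem Subgr.IsFinite.smul {Δ : Subgr ι} (h : Δ.IsFinite) (g : G) : (g • Δ).IsFinite := by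
  constructor
  · exact h.1.preimage (mul_right_injective g⁻¹).injOn
  · refine h.2.preimage (f := fun e : Edge X G => (g⁻¹ * e.1, e.2)) (Function.Injective.injOn ?_)
    rintro ⟨a, b⟩ ⟨a', b'⟩ hab
    simpa using hab

variable (ι)

/-- The subgraph with the single vertex `g` and no edges. -/
def Subgr.vert (g : G) : Subgr ι where
  verts := {g}
  edges := ∅
  src_mem := fun _ h => h.elim
  tgt_mem := fun _ h => h.elim
  rev_mem := fun _ h => h.elim

/-- The subgraph consisting of the edge `e`, its inverse, and its end vertices. -/
def Subgr.edge (e : Edge X G) : Subgr ι where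
  verts := {e.1, Edge.tgt ι e}
  edges := {e, Edge.rev ι e}
  src_mem := by
    rintro _ (rfl | rfl)
    · exact Or.inl rfl
    · exact Or.inr rfl
  tgt_mem := by
    rintro _ (rfl | rfl)
    · exact Or.inr rfl
    · exact Or.inl (Edge.tgt_rev ι e)
  rev_mem := by
    rintro _ (rfl | rfl)
    · exact Or.inr rfl
    · exact Or.inl (Edge.rev_rev ι e)

/-- The subgraph spanned by the path labeled by a given word and starting at `g`. -/
def pathSpan (g : G) : Word X → Subgr ι
  | [] => Subgr.vert ι g
  | a :: p => Subgr.edge ι (g, a) ⊔ pathSpan (g * letter ι a) p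

/-- The subgraph spanned by the journey labeled by a given term and starting at `g`: in
`u v^𝔪 t` one traverses the path labeled by `u`, then jumps from the current vertex `h` to
`h v_G`, and continues with `t` from there. For `g = 1` this is `⟨w̄⟩`. -/
def journeySpan (g : G) : FTerm X → Subgr ι
  | .word a => pathSpan ι g a
  | .jump a b t => pathSpan ι g a ⊔ journeySpan (g * wordVal ι a * wordVal ι b) t

/-- The term `w` labels a journey from `g` to `h` in the subgraph `Δ`. -/
def Labels (Δ : Subgr ι) (t : FTerm X) (g h : G) : Prop :=
  journeySpan ι g t ≤ Δ ∧ g * t.groupVal ι = h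

variable {ι}

theorem Subgr.vert_le_iff {g : G} {Δ : Subgr ι} : Subgr.vert ι g ≤ Δ ↔ g ∈ Δ.verts :=
  ⟨fun h => h.1 rfl, fun h => ⟨fun _ k => by rw [k]; exact h, fun _ k => k.elim⟩⟩

theorem Subgr.vert_finite (g : G) : (Subgr.vert ι g).IsFinite :=
  ⟨Set.finite_singleton _, Set.finite_empty⟩

theorem Subgr.smul_vert (k g : G) : k • Subgr.vert ι g = Subgr.vert ι (k * g) := by
  refine Subgr.ext (Set.ext fun h => ?_) (Set.ext fun e => ?_)
  · change k⁻¹ * h = g ↔ h = k * g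
    exact inv_mul_eq_iff_eq_mul
  · exact Iff.rfl

theorem Subgr.edge_finite (e : Edge X G) : (Subgr.edge ι e).IsFinite :=
  ⟨Set.toFinite {e.1, Edge.tgt ι e}, Set.toFinite {e, Edge.rev ι e}⟩

theorem Subgr.smul_edge (k g : G) (a : X × Bool) :
    k • Subgr.edge ι (g, a) = Subgr.edge ι (k * g, a) := by
  refine Subgr.ext (Set.ext fun h => ?_) (Set.ext fun e => ?_)
  · change (k⁻¹ * h = g ∨ k⁻¹ * h = g * letter ι a) ↔ (h = k * g ∨ h = k * g * letter ι a)
    rw [inv_mul_eq_iff_eq_mul, inv_mul_eq_iff_eq_mul, mul_assoc]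
  · obtain ⟨h, b⟩ := e
    change ((k⁻¹ * h, b) = (g, a) ∨ (k⁻¹ * h, b) = (g * letter ι a, (a.1, !a.2))) ↔
      ((h, b) = (k * g, a) ∨ (h, b) = (k * g * letter ι a, (a.1, !a.2)))
    simp only [Prod.mk.injEq]
    rw [inv_mul_eq_iff_eq_mul, inv_mul_eq_iff_eq_mul, mul_assoc]

theorem smul_pathSpan (k : G) (p : Word X) :
    ∀ g : G, k • pathSpan ι g p = pathSpan ι (k * g) p := by
  induction p with
  | nil => exact fun g => Subgr.smul_vert k g
  | cons a p ih =>
    intro g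
    rw [pathSpan, pathSpan, Subgr.smul_sup, Subgr.smul_edge, ih, mul_assoc]

theorem smul_journeySpan (k : G) (t : FTerm X) :
    ∀ g : G, k • journeySpan ι g t = journeySpan ι (k * g) t := by
  induction t with
  | word a => exact fun g => smul_pathSpan k a g
  | jump a b t ih =>
    intro g
    rw [journeySpan, journeySpan, Subgr.smul_sup, smul_pathSpan, ih]
    simp only [mul_assoc]

theorem labels_smul {k g h : G} {Δ : Subgr ι} {t : FTerm X} :
    Labels ι (k • Δ) t g h ↔ Labels ι Δ t (k⁻¹ * g) (k⁻¹ * h) := by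
  unfold Labels
  rw [← smul_journeySpan, Subgr.smul_le_iff, inv_inv, mul_assoc, mul_right_inj]

end Subgraphs

/-! ### Closure operators -/

/-- `G`-invariant closure operators on the lattice of subgraphs of the Cayley graph. -/
structure InvClosure {X : Type u} {G : Type w} [Group G] (ι : X → G)
    extends ClosureOperator (Subgr ι) where
  smul_closure : ∀ (g : G) (Δ : Subgr ι), toFun (g • Δ) = g • toFun Δ

section Closure

variable {X : Type u} {G : Type w} [Group G] {ι : X → G}

instance : CoeFun (InvClosure ι) (fun _ => Subgr ι → Subgr ι) where
  coe c := c.toClosureOperator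

theorem InvClosure.map_smul (c : InvClosure ι) (g : G) (Δ : Subgr ι) : c (g • Δ) = g • c Δ :=
  c.smul_closure g Δ

/-- Finitary closure operators: `Δ^c` is the union of all `F^c` with `F ⊆ Δ` finite. -/
def InvClosure.Finitary (c : InvClosure ι) : Prop :=
  ∀ Δ : Subgr ι, c Δ = sSup {E | ∃ F : Subgr ι, F ≤ Δ ∧ F.IsFinite ∧ E = c F}

/-- Compact subgraphs: closures of finite subgraphs. -/
def InvClosure.IsCompact (c : InvClosure ι) (Δ : Subgr ι) : Prop :=
  ∃ F : Subgr ι, F.IsFinite ∧ Δ = c F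

theorem InvClosure.IsCompact.closure_eq {c : InvClosure ι} {Δ : Subgr ι} (h : c.IsCompact Δ) :
    c Δ = Δ := by
  obtain ⟨F, -, rfl⟩ := h
  exact c.idempotent F

theorem InvClosure.IsCompact.smul {c : InvClosure ι} {Δ : Subgr ι} (h : c.IsCompact Δ) (g : G) :
    c.IsCompact (g • Δ) := by
  obtain ⟨F, hF, rfl⟩ := h
  exact ⟨g • F, hF.smul g, (c.map_smul g F).symm⟩

theorem InvClosure.IsCompact.mul {c : InvClosure ι} {Δ Ξ : Subgr ι} (h : c.IsCompact Δ)
    (k : c.IsCompact Ξ) (g : G) : c.IsCompact (c (Δ ⊔ g • Ξ)) := by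
  obtain ⟨F, hF, rfl⟩ := h
  obtain ⟨E, hE, rfl⟩ := k
  refine ⟨F ⊔ g • E, hF.sup (hE.smul g), ?_⟩
  rw [← c.map_smul]
  exact c.closure_sup_closure _ _

/-- For a relation `R` on terms, the subgraph `Δ` is closed if for all `(t, t') ∈ R` and all
vertices `g`, `h` of `Δ`, `t` labels a journey from `g` to `h` in `Δ` if and only if `t'` does. -/
def RelClosed (R : FTerm X → FTerm X → Prop) (Δ : Subgr ι) : Prop :=
  ∀ t t' : FTerm X, R t t' → ∀ g ∈ Δ.verts, ∀ h ∈ Δ.verts, Labels ι Δ t g h ↔ Labels ι Δ t' g h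

theorem pathSpan_start_mem (g : G) (p : Word X) : g ∈ (pathSpan ι g p).verts := by
  cases p with
  | nil => exact rfl
  | cons a p => exact Or.inl (Or.inl rfl)

theorem journeySpan_start_mem (g : G) (t : FTerm X) : g ∈ (journeySpan ι g t).verts := by
  cases t with
  | word a => exact pathSpan_start_mem g a
  | jump a b t => exact Or.inl (pathSpan_start_mem g a)

theorem pathSpan_finish_mem (p : Word X) :
    ∀ g : G, g * wordVal ι p ∈ (pathSpan ι g p).verts := by
  induction p with
  | nil => exact fun g => mul_one g
  | cons a p ih =>
    intro g
    rw [wordVal, ← mul_assoc]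
    exact Or.inr (ih _)

theorem journeySpan_finish_mem (t : FTerm X) :
    ∀ g : G, g * t.groupVal ι ∈ (journeySpan ι g t).verts := by
  induction t with
  | word a => exact pathSpan_finish_mem a
  | jump a b t ih =>
    intro g
    have := ih (g * wordVal ι a * wordVal ι b)
    rw [FTerm.groupVal]
    refine Or.inr ?_
    simpa only [mul_assoc] using this

theorem pathSpan_finite (p : Word X) : ∀ g : G, (pathSpan ι g p).IsFinite := by
  induction p with
  | nil => exact fun g => Subgr.vert_finite g
  | cons a p ih => exact fun g => (Subgr.edge_finite _).sup (ih _)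

theorem relClosed_sInf {R : FTerm X → FTerm X → Prop}
    (hR : ∀ t t', R t t' → t.groupVal ι = t'.groupVal ι) (A : Set (Subgr ι))
    (hA : ∀ Δ ∈ A, RelClosed R Δ) : RelClosed R (sInf A) := by
  intro t t' htt g hg h hh
  have key : ∀ s, Labels ι (sInf A) s g h ↔ (g * s.groupVal ι = h ∧ ∀ Δ ∈ A, Labels ι Δ s g h) := by
    intro s
    unfold Labels
    rw [le_sInf_iff]
    exact ⟨fun H => ⟨H.2, fun Δ hΔ => ⟨H.1 Δ hΔ, H.2⟩⟩, fun H => ⟨fun Δ hΔ => (H.2 Δ hΔ).1, H.1⟩⟩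
  rw [key, key, hR t t' htt]
  exact and_congr_right fun _ => forall₂_congr fun Δ hΔ => hA Δ hΔ t t' htt g (hg Δ hΔ) h (hh Δ hΔ)

theorem RelClosed.smul {R : FTerm X → FTerm X → Prop} {Δ : Subgr ι} (hΔ : RelClosed R Δ) (k : G) :
    RelClosed R (k • Δ) := by
  intro t t' htt g hg h hh
  rw [labels_smul, labels_smul]
  exact hΔ t t' htt _ hg _ hh

/-- The `G`-invariant closure operator whose closed subgraphs are those defined by the
relation `R`, any two `R`-related terms being equal in `G`: the closure of `Δ` is the intersection
of all closed subgraphs that contain `Δ`. -/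
def relClosure (R : FTerm X → FTerm X → Prop)
    (hR : ∀ t t', R t t' → t.groupVal ι = t'.groupVal ι) : InvClosure ι where
  toClosureOperator := ClosureOperator.ofCompletePred (RelClosed R) (relClosed_sInf hR)
  smul_closure := by
    set c : ClosureOperator (Subgr ι) :=
      ClosureOperator.ofCompletePred (RelClosed R) (relClosed_sInf hR) with hc
    have hle : ∀ (g : G) (Δ : Subgr ι), c (g • Δ) ≤ g • c Δ := fun g Δ =>
      c.closure_min (Subgr.smul_mono g (c.le_closure Δ))
        (RelClosed.smul (c.isClosed_closure Δ : RelClosed R (c Δ)) g)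
    intro g Δ
    refine le_antisymm (hle g Δ) ?_
    have := hle g⁻¹ (g • Δ)
    rw [inv_smul_smul] at this
    exact Subgr.smul_le_iff.2 this

end Closure

/-! ### The closure operator of an `F`-inverse monoid -/

section ClosureOfMonoid

variable {X : Type u} {S : Type v} [FInverseMonoid S] {G : Type w} [Group G]

theorem map_inv' (π : S →* G) (a : S) : π a⁻¹ = (π a)⁻¹ := by
  have h := congrArg π (InverseMonoid.mul_inv_mul a)
  rw [map_mul, map_mul, mul_assoc, mul_eq_left] at h
  exact eq_inv_of_mul_eq_one_left h

theorem map_natLE (π : S →* G) {a b : S} (h : NatLE a b) : π a = π b := by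
  have h' := congrArg π h
  simpa [map_inv'] using h'

theorem map_mx (π : S →* G) (a : S) : π (FInverseMonoid.mx a) = π a := by
  obtain ⟨r, h, k⟩ := FInverseMonoid.sigma_mx a
  rw [← map_natLE π h, ← map_natLE π k]

theorem map_wordVal {ιS : X → S} {ιG : X → G} (π : S →* G) (hπ : ∀ x, π (ιS x) = ιG x)
    (p : Word X) : π (wordVal ιS p) = wordVal ιG p := by
  induction p with
  | nil => exact map_one π
  | cons a p ih =>
    rw [wordVal, wordVal, map_mul, ih]
    obtain ⟨x, b⟩ := a
    cases b <;> simp [letter, map_inv', hπ]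

theorem map_val {ιS : X → S} {ιG : X → G} (π : S →* G) (hπ : ∀ x, π (ιS x) = ιG x)
    (t : FTerm X) : π (t.val ιS) = t.groupVal ιG := by
  induction t with
  | word a => exact map_wordVal π hπ a
  | jump a b t ih =>
    rw [FTerm.val, FTerm.groupVal, map_mul, map_mul, ih, map_mx, map_wordVal π hπ,
      map_wordVal π hπ]

/-- The closure operator `c_S` on the subgraphs of the Cayley graph of `G`, associated to the
`F`-inverse monoid `S` with generators `ιS` and canonical homomorphism `π` onto `G`: it comes from
the relation consisting of all pairs of terms with the same value in `S`. -/
def closureOf (ιS : X → S) (ιG : X → G) (π : S →* G) (hπ : ∀ x, π (ιS x) = ιG x) :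
    InvClosure ιG :=
  relClosure (fun t t' => t.val ιS = t'.val ιS) fun t t' h => by
    rw [← map_val π hπ, ← map_val π hπ, h]

/-- The `F`-Schützenberger graph `FΓ(w) = ⟨w̄⟩^{c_S}` of a term `w`. -/
def FSchTerm (ιS : X → S) (ιG : X → G) (π : S →* G) (hπ : ∀ x, π (ιS x) = ιG x) (t : FTerm X) :
    Subgr ιG :=
  closureOf ιS ιG π hπ (journeySpan ιG 1 t)

open Classical in
/-- The `F`-Schützenberger graph `FΓ(s)` of an element `s`: it is `FΓ(w)` for some term `w`
with `w_S = s` (such a `w` exists if `S` is generated by `ιS`). -/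
noncomputable def FSch (ιS : X → S) (ιG : X → G) (π : S →* G) (hπ : ∀ x, π (ιS x) = ιG x)
    (s : S) : Subgr ιG :=
  if h : ∃ t : FTerm X, t.val ιS = s then FSchTerm ιS ιG π hπ h.choose else ⊥

end ClosureOfMonoid

/-! ### The `F`-inverse monoid of a closure operator -/

/-- The set `S_c` of pairs `(Δ, g)`, where `Δ` is a compact subgraph containing `1` and `g`. -/
@[ext]
structure ClosureMonoid {X : Type u} {G : Type w} [Group G] {ι : X → G} (c : InvClosure ι) where
  graph : Subgr ι
  elt : G
  compact : c.IsCompact graph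
  one_mem : 1 ∈ graph.verts
  elt_mem : elt ∈ graph.verts

namespace ClosureMonoid

variable {X : Type u} {G : Type w} [Group G] {ι : X → G} {c : InvClosure ι}

theorem closure_graph (a : ClosureMonoid c) : c a.graph = a.graph := a.compact.closure_eq

/-- `(Δ, g)(Ξ, h) = ((Δ ∪ gΞ)^c, gh)`. -/
instance : Mul (ClosureMonoid c) where
  mul a b :=
    { graph := c (a.graph ⊔ a.elt • b.graph)
      elt := a.elt * b.elt
      compact := a.compact.mul b.compact a.elt
      one_mem := (c.le_closure _).1 (Or.inl a.one_mem)
      elt_mem := (c.le_closure _).1 (Or.inr (by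
        rw [Subgr.mem_verts_smul, inv_mul_cancel_left]
        exact b.elt_mem)) }

/-- `(Δ, g)⁻¹ = (g⁻¹Δ, g⁻¹)`. -/
instance : Inv (ClosureMonoid c) where
  inv a :=
    { graph := a.elt⁻¹ • a.graph
      elt := a.elt⁻¹
      compact := a.compact.smul _
      one_mem := by
        rw [Subgr.mem_verts_smul, inv_inv, mul_one]
        exact a.elt_mem
      elt_mem := by
        rw [Subgr.mem_verts_smul, inv_inv, mul_inv_cancel]
        exact a.one_mem }

/-- The identity element `({1}^c, 1)`. -/
instance : One (ClosureMonoid c) where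
  one :=
    { graph := c (Subgr.vert ι 1)
      elt := 1
      compact := ⟨_, Subgr.vert_finite 1, rfl⟩
      one_mem := (c.le_closure _).1 rfl
      elt_mem := (c.le_closure _).1 rfl }

theorem graph_mul (a b : ClosureMonoid c) : (a * b).graph = c (a.graph ⊔ a.elt • b.graph) := rfl

theorem elt_mul (a b : ClosureMonoid c) : (a * b).elt = a.elt * b.elt := rfl

theorem graph_inv (a : ClosureMonoid c) : (a⁻¹).graph = a.elt⁻¹ • a.graph := rfl

theorem elt_inv (a : ClosureMonoid c) : (a⁻¹).elt = a.elt⁻¹ := rfl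

theorem graph_one : (1 : ClosureMonoid c).graph = c (Subgr.vert ι 1) := rfl

theorem elt_one : (1 : ClosureMonoid c).elt = 1 := rfl

instance : Monoid (ClosureMonoid c) where
  mul_assoc a b d := by
    refine ClosureMonoid.ext ?_ (mul_assoc _ _ _)
    simp only [graph_mul, elt_mul]
    rw [c.closure_sup_closure_left, ← c.map_smul, c.closure_sup_closure_right, Subgr.smul_sup,
      mul_smul, sup_assoc]
  one_mul a := by
    refine ClosureMonoid.ext ?_ (one_mul _)
    rw [graph_mul, graph_one, elt_one, one_smul, c.closure_sup_closure_left,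
      sup_eq_right.2 (Subgr.vert_le_iff.2 a.one_mem), closure_graph]
  mul_one a := by
    refine ClosureMonoid.ext ?_ (mul_one _)
    rw [graph_mul, graph_one, ← c.map_smul, c.closure_sup_closure_right, Subgr.smul_vert, mul_one,
      sup_eq_left.2 (Subgr.vert_le_iff.2 a.elt_mem), closure_graph]

theorem graph_mul_inv (a : ClosureMonoid c) : (a * a⁻¹).graph = a.graph := by
  rw [graph_mul, graph_inv, smul_inv_smul, sup_idem, closure_graph]

theorem elt_mul_inv (a : ClosureMonoid c) : (a * a⁻¹).elt = 1 := mul_inv_cancel _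

instance : InverseMonoid (ClosureMonoid c) where
  mul_inv_mul a := by
    refine ClosureMonoid.ext ?_ (by simp [elt_mul, elt_inv])
    rw [graph_mul, graph_mul_inv, elt_mul_inv, one_smul, sup_idem, closure_graph]
  inv_mul_inv a := by
    refine ClosureMonoid.ext ?_ ?_
    · rw [graph_mul, graph_mul, graph_inv, elt_mul, elt_inv, c.closure_sup_closure_left,
        inv_mul_cancel, one_smul, sup_idem, sup_idem, c.map_smul, closure_graph]
    · simp [elt_mul, elt_inv]
  inv_unique a b h k := by
    have he : b.elt = a.elt⁻¹ := by
      have := congrArg elt h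
      rw [elt_mul, elt_mul, mul_assoc, mul_eq_left] at this
      exact eq_inv_of_mul_eq_one_left this
    refine ClosureMonoid.ext (le_antisymm ?_ ?_) he
    · have h' := congrArg graph h
      rw [mul_assoc, graph_mul] at h'
      rw [graph_inv, ← Subgr.smul_le_iff, ← h', graph_mul]
      refine le_trans (Subgr.smul_mono _ ?_) (le_sup_right.trans (c.le_closure _))
      exact le_sup_left.trans (c.le_closure _)
    · have k' := congrArg graph k
      rw [mul_assoc, graph_mul] at k'
      rw [graph_inv, ← he, ← k', graph_mul]
      refine le_trans (Subgr.smul_mono _ ?_) (le_sup_right.trans (c.le_closure _))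
      exact le_sup_left.trans (c.le_closure _)

theorem natLE_iff {a b : ClosureMonoid c} : NatLE a b ↔ a.elt = b.elt ∧ b.graph ≤ a.graph := by
  unfold NatLE
  constructor
  · intro h
    have h1 := congrArg elt h
    rw [elt_mul, elt_mul_inv, one_mul] at h1
    have h2 := congrArg graph h
    rw [graph_mul, graph_mul_inv, elt_mul_inv, one_smul] at h2
    refine ⟨h1, ?_⟩
    rw [h2]
    exact le_sup_right.trans (c.le_closure _)
  · rintro ⟨h1, h2⟩
    refine ClosureMonoid.ext ?_ ?_
    · rw [graph_mul, graph_mul_inv, elt_mul_inv, one_smul, sup_eq_left.2 h2, closure_graph]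
    · rw [elt_mul, elt_mul_inv, one_mul, h1]

/-- The element `({1, g}^c, g)`. -/
def top (c : InvClosure ι) (g : G) : ClosureMonoid c where
  graph := c (Subgr.vert ι 1 ⊔ Subgr.vert ι g)
  elt := g
  compact := ⟨_, (Subgr.vert_finite 1).sup (Subgr.vert_finite g), rfl⟩
  one_mem := (c.le_closure _).1 (Or.inl rfl)
  elt_mem := (c.le_closure _).1 (Or.inr rfl)

theorem le_top (a : ClosureMonoid c) : NatLE a (top c a.elt) := by
  refine natLE_iff.2 ⟨rfl, ?_⟩
  rw [← a.closure_graph]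
  exact c.monotone (sup_le (Subgr.vert_le_iff.2 a.one_mem) (Subgr.vert_le_iff.2 a.elt_mem))

theorem elt_eq_of_sigma {a b : ClosureMonoid c} (h : SigmaRel a b) : a.elt = b.elt := by
  obtain ⟨r, h, k⟩ := h
  rw [← (natLE_iff.1 h).1, (natLE_iff.1 k).1]

/-- `S_c` is an `F`-inverse monoid with `(Δ, g)^𝔪 = ({1, g}^c, g)`. -/
instance : FInverseMonoid (ClosureMonoid c) where
  mx a := top c a.elt
  sigma_mx a := ⟨a, natLE_iff.2 ⟨rfl, le_rfl⟩, le_top a⟩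
  le_mx a b h := by
    rw [elt_eq_of_sigma h]
    exact le_top b

/-- The generators `x ↦ (⟨x̄⟩^c, x_G)` of `S_c`. -/
def gen (c : InvClosure ι) (x : X) : ClosureMonoid c where
  graph := c (pathSpan ι 1 [(x, true)])
  elt := ι x
  compact := ⟨_, pathSpan_finite _ _, rfl⟩
  one_mem := (c.le_closure _).1 (pathSpan_start_mem _ _)
  elt_mem := (c.le_closure _).1 (by
    have := pathSpan_finish_mem (ι := ι) [(x, true)] 1
    simpa [wordVal, letter] using this)

/-- The projection `(Δ, g) ↦ g` of `S_c` onto `G`. -/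
def proj (c : InvClosure ι) : ClosureMonoid c →* G where
  toFun := elt
  map_one' := rfl
  map_mul' _ _ := rfl

/-- The closure operator `c_{S_c}` of the `F`-inverse monoid `S_c`. -/
def closure (c : InvClosure ι) : InvClosure ι :=
  closureOf (gen c) ι (proj c) fun _ => rfl

end ClosureMonoid

end FInv

open FInv

namespace FInv

/-! ### Inverse monoids -/

section InverseMonoids

variable {S : Type v} [InverseMonoid S]

/-! The central point of part 1 is that `c_S` creates no coincidences: if the journey of `s` from
`1` lies in the closure of the journey of `t`, and `s`, `t` agree in `G`, then `t_S ≤ s_S`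
(`natLE_of_journeySpan_le`). To bound the closure from above, put `e = t_S t_S⁻¹`, let `m_g` be the
greatest element of `S` above `g`, and consider the vertices `g` with `e m_g` R-related to `e` and
the edges `(g, a)` with `e m_g a` R-related to `e`. Whenever `e x` is R-related to `e`, it equals `e
m_g` for `g` the image of `x`, so a journey may be followed by remembering only the current vertex.
Hence a journey of `w` from `g` lies in this subgraph iff `e m_g w_S` is R-related to `e`. This
depends only on `w_S`, so the subgraph is closed, and it contains the journey of `t`. Therefore it
contains that of `s`, which gives `e s_S = e m = t_S` with `m` the common greatest element.

Injectivity of `ψ` follows by antisymmetry. Surjectivity holds because jumps allow a single journey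
to span any finite subgraph together with prescribed end vertices (`exists_term_span`).
Compatibility with products is concatenation of journeys.

For part 2, a term `t` has value `(c ⟨t̄⟩, t_G)` in `S_c` (`val_gen_graph`), so `c`-closed subgraphs
are closed for `c_{S_c}`. Conversely, for a finite nonempty `F` and a finite `E ⊆ F^c`, a loop
spanning `F` and the same loop extended by an excursion through `E` have the same value in `S_c`. A
`c_{S_c}`-closed subgraph containing `F` must then contain `E`. Finitarity passes from finite to
arbitrary nonempty subgraphs. -/

theorem inv_eq_self_of_idem {e : S} (he : e * e = e) : e⁻¹ = e :=
  (InverseMonoid.inv_unique e e (by rw [he, he]) (by rw [he, he])).symm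

theorem inv_inv_eq (a : S) : a⁻¹⁻¹ = a :=
  (InverseMonoid.inv_unique a⁻¹ a (InverseMonoid.inv_mul_inv a) (InverseMonoid.mul_inv_mul a)).symm

theorem mul_inv_idem (a : S) : a * a⁻¹ * (a * a⁻¹) = a * a⁻¹ := by
  rw [← mul_assoc, InverseMonoid.mul_inv_mul]

theorem inv_mul_idem (a : S) : a⁻¹ * a * (a⁻¹ * a) = a⁻¹ * a := by
  rw [← mul_assoc, InverseMonoid.inv_mul_inv]

/-- With `x = (e f)⁻¹`, the element `f x e` is also an inverse of `e f`, so it equals `x` by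
uniqueness. This makes `x` idempotent, and `e f`, being the inverse of `x`, coincides with it. -/
theorem idem_mul_idem {e f : S} (he : e * e = e) (hf : f * f = f) : e * f * (e * f) = e * f := by
  have h1 := InverseMonoid.mul_inv_mul (e * f)
  have h2 := InverseMonoid.inv_mul_inv (e * f)
  set x := (e * f)⁻¹ with hx
  have hx' : f * x * e = x := by
    refine InverseMonoid.inv_unique (e * f) (f * x * e) ?_ ?_
    · calc e * f * (f * x * e) * (e * f) = e * (f * f) * x * (e * e) * f := by
            simp only [mul_assoc]
        _ = e * f * x * (e * f) := by rw [he, hf]; simp only [mul_assoc]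
        _ = e * f := h1
    · calc f * x * e * (e * f) * (f * x * e) = f * (x * ((e * e) * (f * f)) * x) * e := by
            simp only [mul_assoc]
        _ = f * x * e := by rw [he, hf, h2]
  have hxx : x * x = x := by
    calc x * x = (f * x * e) * (f * x * e) := by rw [hx']
      _ = f * (x * (e * f) * x) * e := by simp only [mul_assoc]
      _ = x := by rw [h2, hx']
  have : e * f = x := by
    rw [← inv_inv_eq (e * f), ← hx, inv_eq_self_of_idem hxx]
  rw [this, hxx]

/-- Both `f e` and `e f` are inverses of the idempotent `e f`. -/
theorem idem_comm {e f : S} (he : e * e = e) (hf : f * f = f) : e * f = f * e := by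
  have h1 := idem_mul_idem he hf
  have h2 := idem_mul_idem hf he
  have h3 : f * e = (e * f)⁻¹ := by
    refine InverseMonoid.inv_unique (e * f) (f * e) ?_ ?_
    · calc e * f * (f * e) * (e * f) = e * (f * f) * (e * e) * f := by simp only [mul_assoc]
        _ = e * f * (e * f) := by rw [he, hf]; simp only [mul_assoc]
        _ = e * f := h1
    · calc f * e * (e * f) * (f * e) = f * (e * e) * (f * f) * e := by simp only [mul_assoc]
        _ = f * e * (f * e) := by rw [he, hf]; simp only [mul_assoc]
        _ = f * e := h2
  rw [h3, inv_eq_self_of_idem h1]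

theorem mul_inv_rev_eq (a b : S) : (a * b)⁻¹ = b⁻¹ * a⁻¹ := by
  have hc := idem_comm (mul_inv_idem b) (inv_mul_idem a)
  refine (InverseMonoid.inv_unique (a * b) (b⁻¹ * a⁻¹) ?_ ?_).symm
  · calc a * b * (b⁻¹ * a⁻¹) * (a * b) = a * (b * b⁻¹ * (a⁻¹ * a)) * b := by
          simp only [mul_assoc]
      _ = a * a⁻¹ * a * (b * b⁻¹ * b) := by rw [hc]; simp only [mul_assoc]
      _ = a * b := by rw [InverseMonoid.mul_inv_mul, InverseMonoid.mul_inv_mul]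
  · calc b⁻¹ * a⁻¹ * (a * b) * (b⁻¹ * a⁻¹) = b⁻¹ * (a⁻¹ * a * (b * b⁻¹)) * a⁻¹ := by
          simp only [mul_assoc]
      _ = b⁻¹ * b * b⁻¹ * (a⁻¹ * a * a⁻¹) := by rw [← hc]; simp only [mul_assoc]
      _ = b⁻¹ * a⁻¹ := by rw [InverseMonoid.inv_mul_inv, InverseMonoid.inv_mul_inv]

theorem NatLE.antisymm {a b : S} (h : NatLE a b) (k : NatLE b a) : a = b := by
  unfold NatLE at h k
  calc a = a * a⁻¹ * b := h
    _ = a * a⁻¹ * (b * b⁻¹ * a) := by rw [← k]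
    _ = b * b⁻¹ * (a * a⁻¹ * a) := by
        rw [← mul_assoc, idem_comm (mul_inv_idem a) (mul_inv_idem b), mul_assoc]
    _ = b := by rw [InverseMonoid.mul_inv_mul, ← k]

theorem NatLE.inv {a b : S} (h : NatLE a b) : NatLE a⁻¹ b⁻¹ := by
  unfold NatLE at h ⊢
  have h1 : a⁻¹ = b⁻¹ * (a * a⁻¹) := by
    conv_lhs => rw [h, mul_inv_rev_eq, inv_eq_self_of_idem (mul_inv_idem a)]
  have hc := idem_comm (mul_inv_idem a) (mul_inv_idem b)
  rw [inv_inv_eq]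
  symm
  calc a⁻¹ * a * b⁻¹ = b⁻¹ * (a * a⁻¹) * (a * a⁻¹ * b) * b⁻¹ := by rw [← h1, ← h]
    _ = b⁻¹ * (a * a⁻¹ * (a * a⁻¹) * (b * b⁻¹)) := by simp only [mul_assoc]
    _ = b⁻¹ * b * b⁻¹ * (a * a⁻¹) := by rw [mul_inv_idem, hc]; simp only [mul_assoc]
    _ = a⁻¹ := by rw [InverseMonoid.inv_mul_inv, ← h1]

/-- If `e` is idempotent and `e x` has a right multiple equal to `e`, then `e x x⁻¹ = e`. -/
theorem mul_mul_inv_of_right {e x y : S} (he : e * e = e) (h : e * x * y = e) :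
    e * (x * x⁻¹) = e := by
  have hc := idem_comm he (mul_inv_idem x)
  symm
  calc e = e * (x * x⁻¹ * x) * y := by rw [InverseMonoid.mul_inv_mul, h]
    _ = e * (x * x⁻¹) * x * y := by simp only [mul_assoc]
    _ = x * x⁻¹ * (e * x * y) := by rw [hc]; simp only [mul_assoc]
    _ = e * (x * x⁻¹) := by rw [h, hc]

/-- The hypothesis `h` says that `e x` is R-related to `e`, that is `e ≤ x x⁻¹`; since `x = x x⁻¹
m`, the factor `x x⁻¹` is absorbed by `e`. -/
theorem mul_eq_mul_of_natLE {e x y m : S} (he : e * e = e) (h : e * x * y = e) (hm : NatLE x m) :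
    e * x = e * m := by
  unfold NatLE at hm
  rw [hm, ← mul_assoc, mul_mul_inv_of_right he h]

end InverseMonoids

/-! ### Greatest elements of `σ`-classes -/

section MaximalElements

variable {S : Type v} [FInverseMonoid S] {G : Type w} [Group G] {π : S →* G}

theorem IsGreatestGroupImage.le_mx (hG : IsGreatestGroupImage π) {s t : S} (h : π s = π t) :
    NatLE t (FInverseMonoid.mx s) :=
  FInverseMonoid.le_mx s t ((hG.2 s t).1 h)

theorem IsGreatestGroupImage.mx_eq (hG : IsGreatestGroupImage π) {s t : S} (h : π s = π t) :
    FInverseMonoid.mx s = FInverseMonoid.mx t :=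
  NatLE.antisymm (hG.le_mx (by rw [map_mx, h])) (hG.le_mx (by rw [map_mx, h]))

theorem IsGreatestGroupImage.mx_inv (hG : IsGreatestGroupImage π) (s : S) :
    FInverseMonoid.mx s⁻¹ = (FInverseMonoid.mx s)⁻¹ := by
  refine NatLE.antisymm ?_ (hG.le_mx (by rw [map_inv', map_inv', map_mx]))
  rw [← inv_inv_eq (FInverseMonoid.mx s⁻¹)]
  exact NatLE.inv (hG.le_mx (by rw [map_inv', map_mx, map_inv', inv_inv]))

/-- The identity is maximal in the natural order, because `1 ≤ m` reads `1 = 1 1⁻¹ m`. -/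
theorem mx_one_eq : FInverseMonoid.mx (1 : S) = 1 := by
  have h : NatLE (1 : S) (FInverseMonoid.mx 1) :=
    FInverseMonoid.le_mx 1 1 ⟨1, by simp [NatLE, inv_eq_self_of_idem], by
      simp [NatLE, inv_eq_self_of_idem]⟩
  unfold NatLE at h
  rw [inv_eq_self_of_idem (one_mul (1 : S)), one_mul, one_mul] at h
  exact h.symm

/-- The greatest element of `S` above a given element of its greatest group image. -/
noncomputable def IsGreatestGroupImage.maxLift (hG : IsGreatestGroupImage π) (g : G) : S :=
  FInverseMonoid.mx (hG.1 g).choose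

theorem IsGreatestGroupImage.map_maxLift (hG : IsGreatestGroupImage π) (g : G) :
    π (hG.maxLift g) = g := by
  rw [maxLift, map_mx, (hG.1 g).choose_spec]

theorem IsGreatestGroupImage.le_maxLift (hG : IsGreatestGroupImage π) {s : S} {g : G}
    (h : π s = g) : NatLE s (hG.maxLift g) :=
  hG.le_mx (by rw [(hG.1 g).choose_spec, h])

theorem IsGreatestGroupImage.maxLift_map (hG : IsGreatestGroupImage π) (s : S) :
    hG.maxLift (π s) = FInverseMonoid.mx s :=
  hG.mx_eq (hG.1 (π s)).choose_spec

end MaximalElements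

/-! ### Concatenation of terms -/

section Terms

variable {X : Type u}

/-- Concatenation of terms. -/
def FTerm.append : FTerm X → FTerm X → FTerm X
  | .word a, .word b => .word (a ++ b)
  | .word a, .jump u v t => .jump (a ++ u) v t
  | .jump u v t, s => .jump u v (t.append s)

theorem wordVal_append {M : Type v} [Monoid M] [Inv M] (ι : X → M) (p q : Word X) :
    wordVal ι (p ++ q) = wordVal ι p * wordVal ι q := by
  induction p with
  | nil => exact (one_mul _).symm
  | cons a p ih => rw [List.cons_append, wordVal, wordVal, ih, mul_assoc]

theorem wordVal_singleton {M : Type v} [Monoid M] [Inv M] (ι : X → M) (a : X × Bool) :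
    wordVal ι [a] = letter ι a :=
  mul_one _

theorem FTerm.val_append {S : Type v} [FInverseMonoid S] (ι : X → S) (t s : FTerm X) :
    (t.append s).val ι = t.val ι * s.val ι := by
  induction t with
  | word a =>
    cases s with
    | word b => exact wordVal_append ι a b
    | jump u v s => simp only [append, val, wordVal_append, mul_assoc]
  | jump u v t ih => simp only [append, val, ih, mul_assoc]

variable {G : Type w} [Group G] {ι : X → G}

theorem FTerm.groupVal_append (t s : FTerm X) :
    (t.append s).groupVal ι = t.groupVal ι * s.groupVal ι := by
  induction t with
  | word a =>
    cases s with
    | word b => exact wordVal_append ι a b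
    | jump u v s => simp only [append, groupVal, wordVal_append, mul_assoc]
  | jump u v t ih => simp only [append, groupVal, ih, mul_assoc]

theorem pathSpan_append (p q : Word X) :
    ∀ g : G, pathSpan ι g (p ++ q) = pathSpan ι g p ⊔ pathSpan ι (g * wordVal ι p) q := by
  induction p with
  | nil =>
    intro g
    rw [List.nil_append, pathSpan, wordVal, mul_one]
    exact (sup_eq_right.2 (Subgr.vert_le_iff.2 (pathSpan_start_mem g q))).symm
  | cons a p ih =>
    intro g
    rw [List.cons_append, pathSpan, pathSpan, ih, wordVal, sup_assoc, mul_assoc]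

theorem journeySpan_append (t s : FTerm X) :
    ∀ g : G, journeySpan ι g (t.append s) =
      journeySpan ι g t ⊔ journeySpan ι (g * t.groupVal ι) s := by
  induction t with
  | word a =>
    intro g
    cases s with
    | word b => exact pathSpan_append a b g
    | jump u v s =>
      simp only [FTerm.append, journeySpan, FTerm.groupVal, pathSpan_append, wordVal_append,
        sup_assoc, mul_assoc]
  | jump u v t ih =>
    intro g
    simp only [FTerm.append, journeySpan, FTerm.groupVal, ih, sup_assoc, mul_assoc]

theorem journeySpan_finite (t : FTerm X) : ∀ g : G, (journeySpan ι g t).IsFinite := by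
  induction t with
  | word a => exact pathSpan_finite a
  | jump a b t ih => exact fun g => (pathSpan_finite a g).sup (ih _)

end Terms

/-! ### Terms with prescribed values and spans -/

section TermValues

variable {X : Type u} {S : Type v} [FInverseMonoid S] {G : Type w} [Group G] {ιS : X → S}
  {ιG : X → G} {π : S →* G}

/-- The preimage in `S` of the subgroup generated by `X` is closed under all operations, including
`(·)^𝔪`, which does not change the image in `G`. -/
theorem closure_range_eq_top (hπ : ∀ x, π (ιS x) = ιG x) (hS : Generates ιS)
    (hG : IsGreatestGroupImage π) : Subgroup.closure (Set.range ιG) = ⊤ := by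
  refine (Subgroup.eq_top_iff' _).2 fun g => ?_
  obtain ⟨s, rfl⟩ := hG.1 g
  refine hS {s | π s ∈ Subgroup.closure (Set.range ιG)} ?_ ?_ ?_ ?_ ?_ s
  · exact fun x => by
      rw [Set.mem_ofPred_eq, hπ]
      exact Subgroup.subset_closure ⟨x, rfl⟩
  · simp [one_mem]
  · exact fun a ha b hb => by simpa using mul_mem ha hb
  · exact fun a ha => by simpa [map_inv'] using ha
  · exact fun a ha => by simpa [map_mx] using ha

theorem exists_wordVal_eq (hι : Subgroup.closure (Set.range ιG) = ⊤) (g : G) :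
    ∃ p : Word X, wordVal ιG p = g := by
  have hg : g ∈ Subgroup.closure (Set.range ιG) := hι ▸ Subgroup.mem_top g
  induction hg using Subgroup.closure_induction'' with
  | mem x hx =>
    obtain ⟨x, rfl⟩ := hx
    exact ⟨[(x, true)], by simp [wordVal, letter]⟩
  | inv_mem x hx =>
    obtain ⟨x, rfl⟩ := hx
    exact ⟨[(x, false)], by simp [wordVal, letter]⟩
  | one => exact ⟨[], rfl⟩
  | mul x y _ _ hx hy =>
    obtain ⟨p, rfl⟩ := hx
    obtain ⟨q, rfl⟩ := hy
    exact ⟨p ++ q, wordVal_append _ _ _⟩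

theorem exists_wordVal_inv (p : Word X) : ∃ q : Word X, wordVal ιS q = (wordVal ιS p)⁻¹ := by
  induction p with
  | nil => exact ⟨[], (inv_eq_self_of_idem (one_mul 1)).symm⟩
  | cons a p ih =>
    obtain ⟨q, hq⟩ := ih
    refine ⟨q ++ [(a.1, !a.2)], ?_⟩
    rw [wordVal_append, hq, wordVal_singleton, wordVal, mul_inv_rev_eq]
    obtain ⟨x, b⟩ := a
    cases b <;> simp [letter, inv_inv_eq]

theorem exists_val_inv (hG : IsGreatestGroupImage π) (t : FTerm X) :
    ∃ s : FTerm X, s.val ιS = (t.val ιS)⁻¹ := by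
  induction t with
  | word a =>
    obtain ⟨q, hq⟩ := exists_wordVal_inv (ιS := ιS) a
    exact ⟨.word q, hq⟩
  | jump a b t ih =>
    obtain ⟨s, hs⟩ := ih
    obtain ⟨p, hp⟩ := exists_wordVal_inv (ιS := ιS) a
    obtain ⟨q, hq⟩ := exists_wordVal_inv (ιS := ιS) b
    refine ⟨s.append (.jump [] q (.word p)), ?_⟩
    simp only [FTerm.val_append, FTerm.val, hs, hp, hq, hG.mx_inv, mul_inv_rev_eq, wordVal,
      one_mul]

/-- The value of `v^𝔪` for a word `v` with a prescribed value in `G`. -/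
theorem exists_jump_val (hπ : ∀ x, π (ιS x) = ιG x) (hS : Generates ιS)
    (hG : IsGreatestGroupImage π) (s : S) : ∃ b : Word X,
      wordVal ιG b = π s ∧ (FTerm.jump [] b (.word [])).val ιS = FInverseMonoid.mx s := by
  obtain ⟨b, hb⟩ := exists_wordVal_eq (closure_range_eq_top hπ hS hG) (π s)
  refine ⟨b, hb, ?_⟩
  rw [FTerm.val, FTerm.val, wordVal, one_mul, mul_one]
  exact hG.mx_eq (by rw [map_wordVal π hπ, hb])

/-- Terms do not nest `(·)^𝔪`, yet their values are closed under it: `s^𝔪` depends only on the image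
of `s` in `G`, and that image is the value of a word. -/
theorem exists_val_eq (hπ : ∀ x, π (ιS x) = ιG x) (hS : Generates ιS)
    (hG : IsGreatestGroupImage π) (s : S) : ∃ t : FTerm X, t.val ιS = s := by
  refine hS {s | ∃ t : FTerm X, t.val ιS = s} ?_ ?_ ?_ ?_ ?_ s
  · exact fun x => ⟨.word [(x, true)], by simp [FTerm.val, wordVal, letter]⟩
  · exact ⟨.word [], rfl⟩
  · rintro _ ⟨t, rfl⟩ _ ⟨t', rfl⟩
    exact ⟨t.append t', FTerm.val_append _ _ _⟩
  · rintro _ ⟨t, rfl⟩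
    exact exists_val_inv hG t
  · rintro s -
    obtain ⟨b, -, hb⟩ := exists_jump_val hπ hS hG s
    exact ⟨_, hb⟩

end TermValues

/-! ### Journeys spanning a prescribed finite subgraph -/

section TermSpans

variable {X : Type u} {G : Type w} [Group G] {ι : X → G}

theorem Subgr.edge_le_iff {e : Edge X G} {Δ : Subgr ι} : Subgr.edge ι e ≤ Δ ↔ e ∈ Δ.edges := by
  refine ⟨fun h => h.2 (Or.inl rfl), fun h => ⟨?_, ?_⟩⟩
  · rintro _ (rfl | rfl)
    exacts [Δ.src_mem _ h, Δ.tgt_mem _ h]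
  · rintro _ (rfl | rfl)
    exacts [h, Δ.rev_mem _ h]

theorem Subgr.edge_rev (e : Edge X G) : Subgr.edge ι (Edge.rev ι e) = Subgr.edge ι e := by
  refine le_antisymm (Subgr.edge_le_iff.2 (Or.inr rfl)) (Subgr.edge_le_iff.2 ?_)
  exact Or.inr (Edge.rev_rev ι e).symm

theorem Subgr.eq_sSup (Δ : Subgr ι) :
    Δ = sSup (Subgr.vert ι '' Δ.verts ∪ Subgr.edge ι '' Δ.edges) := by
  refine le_antisymm (show _ ∧ _ from ⟨fun g hg => ?_, fun e he => ?_⟩) (sSup_le fun E hE => ?_)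
  · exact ⟨_, Or.inl ⟨g, hg, rfl⟩, rfl⟩
  · exact ⟨_, Or.inr ⟨e, he, rfl⟩, Or.inl rfl⟩
  · obtain ⟨g, hg, rfl⟩ | ⟨e, he, rfl⟩ := hE
    exacts [Subgr.vert_le_iff.2 hg, Subgr.edge_le_iff.2 he]

theorem pathSpan_singleton (g : G) (a : X × Bool) :
    pathSpan ι g [a] = Subgr.edge ι (g, a) :=
  sup_eq_left.2 (Subgr.vert_le_iff.2 (Or.inr rfl))

theorem journeySpan_jump (b : Word X) (t : FTerm X) (g : G) :
    journeySpan ι g (.jump [] b t) = Subgr.vert ι g ⊔ journeySpan ι (g * wordVal ι b) t := by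
  rw [journeySpan, wordVal, mul_one, pathSpan]

/-- Every finite subgraph containing `1` is spanned by a journey from `1` to `1`. -/
theorem exists_loop_span (hι : Subgroup.closure (Set.range ι) = ⊤) {F : Subgr ι}
    (hF : F.IsFinite) :
    ∃ t : FTerm X, journeySpan ι 1 t = Subgr.vert ι 1 ⊔ F ∧ t.groupVal ι = 1 := by
  -- Concatenating loops at `1` joins their spans, so it suffices to treat a single vertex and a
  -- single edge.
  have key : ∀ A : Set (Subgr ι), A.Finite →
      (∀ E ∈ A, ∃ t : FTerm X, journeySpan ι 1 t = Subgr.vert ι 1 ⊔ E ∧ t.groupVal ι = 1) →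
      ∃ t : FTerm X, journeySpan ι 1 t = Subgr.vert ι 1 ⊔ sSup A ∧ t.groupVal ι = 1 := by
    intro A hA
    induction A, hA using Set.Finite.induction_on with
    | empty =>
      refine fun _ => ⟨.word [], ?_, rfl⟩
      rw [sSup_empty, sup_bot_eq]
      rfl
    | @insert E A _ _ ih =>
      intro h
      obtain ⟨t, ht, ht'⟩ := ih fun E hE => h E (Or.inr hE)
      obtain ⟨s, hs, hs'⟩ := h E (Or.inl rfl)
      refine ⟨s.append t, ?_, by rw [FTerm.groupVal_append, hs', ht', one_mul]⟩
      rw [journeySpan_append, hs', one_mul, hs, ht, sSup_insert, sup_sup_sup_comm, sup_idem]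
  rw [Subgr.eq_sSup F]
  refine key _ ((hF.1.image _).union (hF.2.image _)) ?_
  rintro _ (⟨g, -, rfl⟩ | ⟨⟨g, a⟩, -, rfl⟩)
  · obtain ⟨p, hp⟩ := exists_wordVal_eq hι g
    obtain ⟨q, hq⟩ := exists_wordVal_eq hι g⁻¹
    -- Jump to `g` and back; jumps contribute only their end vertices.
    refine ⟨.jump [] p (.jump [] q (.word [])), ?_, ?_⟩
    · rw [journeySpan_jump, journeySpan_jump, hp, hq, one_mul, mul_inv_cancel, journeySpan,
        pathSpan, sup_left_comm, sup_idem, sup_comm]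
    · simp [FTerm.groupVal, wordVal, hp, hq]
  · obtain ⟨p, hp⟩ := exists_wordVal_eq hι g
    obtain ⟨q, hq⟩ := exists_wordVal_eq hι (g * letter ι a)⁻¹
    -- Jump to `g`, traverse the edge, and jump back to `1`.
    refine ⟨.jump [] p (.jump [a] q (.word [])), ?_, ?_⟩
    · rw [journeySpan_jump, journeySpan, hp, hq, one_mul, wordVal_singleton, mul_inv_cancel,
        journeySpan, pathSpan_singleton, pathSpan, sup_left_comm, sup_idem, sup_comm]
    · simp [FTerm.groupVal, wordVal, hp, hq]

theorem exists_term_span (hι : Subgroup.closure (Set.range ι) = ⊤) {F : Subgr ι}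
    (hF : F.IsFinite) (g : G) :
    ∃ t : FTerm X, journeySpan ι 1 t = F ⊔ (Subgr.vert ι 1 ⊔ Subgr.vert ι g) ∧
      t.groupVal ι = g := by
  obtain ⟨t, ht, ht'⟩ := exists_loop_span hι hF
  obtain ⟨p, hp⟩ := exists_wordVal_eq hι g
  refine ⟨t.append (.jump [] p (.word [])), ?_, ?_⟩
  · rw [journeySpan_append, ht, ht', journeySpan_jump, one_mul, one_mul, hp, journeySpan, pathSpan,
      sup_comm (Subgr.vert ι 1) F, sup_assoc, ← sup_assoc (Subgr.vert ι 1), sup_idem]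
  · rw [FTerm.groupVal_append, ht', one_mul]
    simp [FTerm.groupVal, wordVal, hp]

end TermSpans

/-! ### The subgraph of an idempotent -/

section IdempotentSubgraph

variable {X : Type u} {S : Type v} [FInverseMonoid S] {G : Type w} [Group G] {ιS : X → S}
  {ιG : X → G} {π : S →* G}

theorem map_letter (hπ : ∀ x, π (ιS x) = ιG x) (a : X × Bool) : π (letter ιS a) = letter ιG a := by
  obtain ⟨x, b⟩ := a
  cases b <;> simp [letter, map_inv', hπ]

theorem IsGreatestGroupImage.mul_eq_mul_maxLift (hG : IsGreatestGroupImage π) {e x : S} {g : G}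
    (he : e * e = e) (h : ∃ y, e * x * y = e) (hx : π x = g) : e * x = e * hG.maxLift g :=
  h.elim fun _ hy => mul_eq_mul_of_natLE he hy (hG.le_maxLift hx)

/-- If `e ≤ p p⁻¹` and `e ≤ q q⁻¹` for the greatest elements `p`, `q` above `h` and `h k`, then
`e p m = e q` for the greatest element `m` above `k`. -/
theorem IsGreatestGroupImage.mul_maxLift_mul (hG : IsGreatestGroupImage π) {e m : S} {h k : G}
    (he : e * e = e) (hh : ∃ y, e * hG.maxLift h * y = e)
    (hk : ∃ y, e * hG.maxLift (h * k) * y = e) (hm : ∀ s, π s = k → NatLE s m) :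
    e * hG.maxLift h * m = e * hG.maxLift (h * k) := by
  obtain ⟨y, hy⟩ := hh
  obtain ⟨z, hz⟩ := hk
  have hp := mul_mul_inv_of_right he hy
  have hq := mul_mul_inv_of_right he hz
  have he1 : π e = 1 := by simpa using congrArg π he
  have hpe : hG.maxLift h * (hG.maxLift h)⁻¹ * e = e := by
    rw [← idem_comm he (mul_inv_idem _), hp]
  -- With `p`, `q` the greatest elements above `h`, `h k`, the element `p⁻¹ e q` maps to `k`, so it
  -- lies below `m`. Multiplying this inequality, written as an equation, by `p` on the left yields
  -- the claim.
  have hle := hm ((hG.maxLift h)⁻¹ * (e * hG.maxLift (h * k))) (by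
    rw [map_mul, map_mul, map_inv', hG.map_maxLift, hG.map_maxLift, he1]; group)
  unfold NatLE at hle
  rw [mul_inv_rev_eq, mul_inv_rev_eq, inv_inv_eq, inv_eq_self_of_idem he] at hle
  set p := hG.maxLift h
  set q := hG.maxLift (h * k)
  symm
  calc e * q = p * (p⁻¹ * (e * q)) := by rw [← mul_assoc, ← mul_assoc, hpe]
    _ = p * p⁻¹ * e * (q * q⁻¹) * e * p * m := by rw [hle]; simp only [mul_assoc]
    _ = e * p * m := by rw [hpe, hq, he]

/-- The subgraph of an idempotent `e`: a journey starting at `g` and labeled by `w` lies in it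
if and only if `e m w_S` is `R`-related to `e`, where `m` is the greatest element above `g`. -/
def idemSubgr (hπ : ∀ x, π (ιS x) = ιG x) (hG : IsGreatestGroupImage π) {e : S}
    (he : e * e = e) : Subgr ιG where
  verts := {g | ∃ y, e * hG.maxLift g * y = e}
  edges := {d | ∃ y, e * (hG.maxLift d.1 * letter ιS d.2) * y = e}
  src_mem := fun d ⟨y, hy⟩ => ⟨letter ιS d.2 * y, by simpa only [mul_assoc] using hy⟩
  tgt_mem := fun d h => by
    rw [Set.mem_ofPred_eq, ← hG.mul_eq_mul_maxLift he h
      (by rw [map_mul, hG.map_maxLift, map_letter hπ]; rfl)]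
    exact h
  rev_mem := fun d h => by
    have h' := hG.mul_eq_mul_maxLift (g := Edge.tgt ιG d) he h
      (by rw [map_mul, hG.map_maxLift, map_letter hπ]; rfl)
    obtain ⟨y, hy⟩ := h
    -- Return along the inverse edge by traversing the edge again: `a a⁻¹ a = a`, after which `y`
    -- leads back to `e`.
    refine ⟨letter ιS d.2 * y, ?_⟩
    have hl : letter ιS d.2 * letter ιS (d.2.1, !d.2.2) * letter ιS d.2 = letter ιS d.2 := by
      obtain ⟨g, x, b⟩ := d
      cases b
      · simpa [letter] using InverseMonoid.inv_mul_inv (ιS x)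
      · simpa [letter] using InverseMonoid.mul_inv_mul (ιS x)
    calc e * (hG.maxLift (Edge.tgt ιG d) * letter ιS (d.2.1, !d.2.2)) * (letter ιS d.2 * y)
        = e * (hG.maxLift d.1 * letter ιS d.2) * letter ιS (d.2.1, !d.2.2) *
            (letter ιS d.2 * y) := by rw [h']; simp only [mul_assoc]
      _ = e * (hG.maxLift d.1 * (letter ιS d.2 * letter ιS (d.2.1, !d.2.2) * letter ιS d.2)) *
            y := by simp only [mul_assoc]
      _ = e := by rw [hl, hy]

theorem pathSpan_le_idemSubgr (hπ : ∀ x, π (ιS x) = ιG x) (hG : IsGreatestGroupImage π) {e : S}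
    (he : e * e = e) (p : Word X) : ∀ g : G, pathSpan ιG g p ≤ idemSubgr hπ hG he ↔
      ∃ y, e * (hG.maxLift g * wordVal ιS p) * y = e := by
  induction p with
  | nil =>
    intro g
    rw [pathSpan, Subgr.vert_le_iff, wordVal, mul_one]
    exact Iff.rfl
  | cons a p ih =>
    intro g
    rw [pathSpan, sup_le_iff, ih, Subgr.edge_le_iff, wordVal]
    have hm : (∃ y, e * (hG.maxLift g * letter ιS a) * y = e) →
        e * (hG.maxLift g * (letter ιS a * wordVal ιS p)) =
          e * (hG.maxLift (g * letter ιG a) * wordVal ιS p) := fun h => by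
      rw [← mul_assoc e (hG.maxLift (g * _)), ← hG.mul_eq_mul_maxLift he h
        (by rw [map_mul, hG.map_maxLift, map_letter hπ])]
      simp only [mul_assoc]
    constructor
    · rintro ⟨h, k⟩
      rwa [hm h]
    · rintro h
      have h' : ∃ y, e * (hG.maxLift g * letter ιS a) * y = e :=
        h.elim fun y hy => ⟨wordVal ιS p * y, by simpa only [mul_assoc] using hy⟩
      exact ⟨h', by rwa [← hm h']⟩

/-- Each completed prefix can be replaced by the greatest element above the vertex reached, so the
condition on `e m_g w_S` splits into the conditions on the separate paths. -/
theorem journeySpan_le_idemSubgr (hπ : ∀ x, π (ιS x) = ιG x) (hG : IsGreatestGroupImage π) {e : S}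
    (he : e * e = e) (t : FTerm X) : ∀ g : G, journeySpan ιG g t ≤ idemSubgr hπ hG he ↔
      ∃ y, e * (hG.maxLift g * t.val ιS) * y = e := by
  induction t with
  | word a => exact fun g => pathSpan_le_idemSubgr hπ hG he a g
  | jump a b t ih =>
    intro g
    rw [journeySpan, sup_le_iff, ih, pathSpan_le_idemSubgr, FTerm.val]
    set m := FInverseMonoid.mx (wordVal ιS b)
    have hm : π m = wordVal ιG b := by rw [map_mx, map_wordVal π hπ]
    have ha : (∃ y, e * (hG.maxLift g * wordVal ιS a) * y = e) →
        e * (hG.maxLift g * wordVal ιS a) = e * hG.maxLift (g * wordVal ιG a) := fun h =>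
      hG.mul_eq_mul_maxLift he h (by rw [map_mul, hG.map_maxLift, map_wordVal π hπ])
    have split : e * (hG.maxLift g * (wordVal ιS a * m * t.val ιS)) =
        e * (hG.maxLift g * wordVal ιS a) * m * t.val ιS := by simp only [mul_assoc]
    rw [split]
    constructor
    · rintro ⟨h, y, hy⟩
      rw [ha h]
      rw [ha h] at h
      -- Plain absorption is not available here: that `e m_h v^𝔪` is R-related to `e` is not yet
      -- known. It follows from both ends of the jump being vertices, using that `v^𝔪` is greatest
      -- in its class.
      rw [hG.mul_maxLift_mul he h ⟨t.val ιS * y, by simpa only [mul_assoc] using hy⟩ fun s hs =>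
        hG.le_mx (by rw [map_wordVal π hπ, hs]), mul_assoc e]
      exact ⟨y, hy⟩
    · rintro ⟨y, hy⟩
      have h : ∃ y, e * (hG.maxLift g * wordVal ιS a) * y = e :=
        ⟨m * t.val ιS * y, by simpa only [mul_assoc] using hy⟩
      refine ⟨h, y, ?_⟩
      rw [ha h, mul_assoc e, hG.mul_eq_mul_maxLift he (x := hG.maxLift (g * wordVal ιG a) * m)
        (g := g * wordVal ιG a * wordVal ιG b)
        ⟨t.val ιS * y, by simpa only [mul_assoc] using hy⟩
        (by rw [map_mul, hG.map_maxLift, hm])] at hy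
      rwa [← mul_assoc]

theorem relClosed_idemSubgr (hπ : ∀ x, π (ιS x) = ιG x) (hG : IsGreatestGroupImage π) {e : S}
    (he : e * e = e) :
    RelClosed (fun t t' => t.val ιS = t'.val ιS) (idemSubgr (ιG := ιG) hπ hG he) := by
  intro t t' h g _ k _
  rw [Labels, Labels, journeySpan_le_idemSubgr, journeySpan_le_idemSubgr, h, ← map_val π hπ,
    ← map_val π hπ, h]

theorem IsGreatestGroupImage.maxLift_one (hG : IsGreatestGroupImage π) : hG.maxLift 1 = 1 := by
  rw [← map_one π, hG.maxLift_map, mx_one_eq]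

theorem closureOf_isClosed_iff (hπ : ∀ x, π (ιS x) = ιG x) {Δ : Subgr ιG} :
    (closureOf ιS ιG π hπ).IsClosed Δ ↔ RelClosed (fun t t' => t.val ιS = t'.val ιS) Δ :=
  Iff.rfl

/-- The subgraph of `e = t_S t_S⁻¹` is closed and contains the journey of `t` from `1`, hence that
of `s`. So `e s_S` is R-related to `e` and equals `e m`, with `m` the greatest element above the
common image; also `t_S = e m` since `t_S ≤ m`. -/
theorem natLE_of_journeySpan_le (hπ : ∀ x, π (ιS x) = ιG x) (hG : IsGreatestGroupImage π)
    {t s : FTerm X} (hs : journeySpan ιG 1 s ≤ closureOf ιS ιG π hπ (journeySpan ιG 1 t))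
    (h : π (t.val ιS) = π (s.val ιS)) : NatLE (t.val ιS) (s.val ιS) := by
  have he := mul_inv_idem (t.val ιS)
  have hle : closureOf ιS ιG π hπ (journeySpan ιG 1 t) ≤ idemSubgr hπ hG he := by
    refine ClosureOperator.closure_min ?_
      ((closureOf_isClosed_iff hπ).2 (relClosed_idemSubgr hπ hG he))
    rw [journeySpan_le_idemSubgr, hG.maxLift_one, one_mul]
    exact ⟨(t.val ιS)⁻¹, by rw [InverseMonoid.mul_inv_mul]⟩
  have h' := (journeySpan_le_idemSubgr hπ hG he s 1).1 (hs.trans hle)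
  rw [hG.maxLift_one, one_mul] at h'
  unfold NatLE
  rw [hG.mul_eq_mul_maxLift he h' h.symm]
  exact hG.le_maxLift rfl

end IdempotentSubgraph

/-! ### `F`-Schützenberger graphs -/

section SchuetzenbergerGraphs

variable {X : Type u} {S : Type v} [FInverseMonoid S] {G : Type w} [Group G] {ιS : X → S}
  {ιG : X → G} {π : S →* G}

/-- The closure of the journey of `s` is a closed subgraph in which `s` labels a journey from `1`;
therefore `t` labels one too. -/
theorem FSchTerm_le_of_val_eq (hπ : ∀ x, π (ιS x) = ιG x) {t s : FTerm X}
    (h : t.val ιS = s.val ιS) : FSchTerm ιS ιG π hπ t ≤ FSchTerm ιS ιG π hπ s := by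
  have hcl : RelClosed (fun t t' => t.val ιS = t'.val ιS) (FSchTerm ιS ιG π hπ s) :=
    (closureOf_isClosed_iff hπ).1 (ClosureOperator.isClosed_closure _ _)
  have hle : journeySpan ιG 1 s ≤ FSchTerm ιS ιG π hπ s := ClosureOperator.le_closure _ _
  refine ClosureOperator.closure_min ?_ ((closureOf_isClosed_iff hπ).2 hcl)
  exact ((hcl t s h 1 (hle.1 (journeySpan_start_mem 1 s)) _
    (hle.1 (journeySpan_finish_mem s 1))).2 ⟨hle, rfl⟩).1

theorem FSch_val (hπ : ∀ x, π (ιS x) = ιG x) (t : FTerm X) :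
    FSch ιS ιG π hπ (t.val ιS) = FSchTerm ιS ιG π hπ t := by
  have h : ∃ t' : FTerm X, t'.val ιS = t.val ιS := ⟨t, rfl⟩
  rw [FSch, dif_pos h]
  exact le_antisymm (FSchTerm_le_of_val_eq hπ h.choose_spec)
    (FSchTerm_le_of_val_eq hπ h.choose_spec.symm)

theorem InvClosure.verts_subset (c : InvClosure ιG) (Δ : Subgr ιG) : Δ.verts ⊆ (c Δ).verts :=
  (c.le_closure Δ).1

/-- The element `(FΓ(s), sσ)`. -/
noncomputable def toClosureMonoid (hπ : ∀ x, π (ιS x) = ιG x) (hS : Generates ιS)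
    (hG : IsGreatestGroupImage π) (s : S) : ClosureMonoid (closureOf ιS ιG π hπ) where
  graph := FSch ιS ιG π hπ s
  elt := π s
  compact := by
    obtain ⟨t, rfl⟩ := exists_val_eq hπ hS hG s
    exact ⟨_, journeySpan_finite t 1, FSch_val hπ t⟩
  one_mem := by
    obtain ⟨t, rfl⟩ := exists_val_eq hπ hS hG s
    rw [FSch_val]
    exact InvClosure.verts_subset _ _ (journeySpan_start_mem 1 t)
  elt_mem := by
    obtain ⟨t, rfl⟩ := exists_val_eq hπ hS hG s
    rw [FSch_val, map_val π hπ]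
    have := journeySpan_finish_mem (ι := ιG) t 1
    rw [one_mul] at this
    exact InvClosure.verts_subset _ _ this

/-! ### The map `ψ` is an isomorphism -/

theorem toClosureMonoid_mul (hπ : ∀ x, π (ιS x) = ιG x) (hS : Generates ιS)
    (hG : IsGreatestGroupImage π) (a b : S) : toClosureMonoid hπ hS hG (a * b) =
      toClosureMonoid hπ hS hG a * toClosureMonoid hπ hS hG b := by
  refine ClosureMonoid.ext ?_ (map_mul π a b)
  obtain ⟨t, rfl⟩ := exists_val_eq hπ hS hG a
  obtain ⟨s, rfl⟩ := exists_val_eq hπ hS hG b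
  simp only [ClosureMonoid.graph_mul, toClosureMonoid]
  rw [← FTerm.val_append, FSch_val, FSch_val, FSch_val, FSchTerm, FSchTerm, FSchTerm,
    ← InvClosure.map_smul, ClosureOperator.closure_sup_closure, smul_journeySpan, mul_one,
    journeySpan_append, one_mul, map_val π hπ]

/-- The element `s^𝔪` is the value of a single jump, whose span consists of the vertices `1` and `π
s` alone. -/
theorem toClosureMonoid_mx (hπ : ∀ x, π (ιS x) = ιG x) (hS : Generates ιS)
    (hG : IsGreatestGroupImage π) (s : S) : toClosureMonoid hπ hS hG (FInverseMonoid.mx s) =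
      FInverseMonoid.mx (toClosureMonoid hπ hS hG s) := by
  refine ClosureMonoid.ext ?_ (map_mx π s)
  obtain ⟨b, hb, hb'⟩ := exists_jump_val hπ hS hG s
  change FSch ιS ιG π hπ (FInverseMonoid.mx s) =
    closureOf ιS ιG π hπ (Subgr.vert ιG 1 ⊔ Subgr.vert ιG (π s))
  rw [← hb', FSch_val, FSchTerm, journeySpan_jump, hb, one_mul]
  rfl

theorem toClosureMonoid_injective (hπ : ∀ x, π (ιS x) = ιG x) (hS : Generates ιS)
    (hG : IsGreatestGroupImage π) : Function.Injective (toClosureMonoid hπ hS hG) := by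
  intro a b h
  have h1 : FSch ιS ιG π hπ a = FSch ιS ιG π hπ b := congrArg ClosureMonoid.graph h
  have h2 : π a = π b := congrArg ClosureMonoid.elt h
  obtain ⟨t, rfl⟩ := exists_val_eq hπ hS hG a
  obtain ⟨s, rfl⟩ := exists_val_eq hπ hS hG b
  rw [FSch_val, FSch_val] at h1
  refine NatLE.antisymm (natLE_of_journeySpan_le hπ hG ?_ h2)
    (natLE_of_journeySpan_le hπ hG ?_ h2.symm)
  · exact (ClosureOperator.le_closure _ _).trans h1.ge
  · exact (ClosureOperator.le_closure _ _).trans h1.le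

/-- A compact graph is the closure of a finite `F`; a journey to the required end vertex spans `F`
with `1` and that vertex adjoined. Both already lie in the closure, which therefore does not change.
-/
theorem toClosureMonoid_surjective (hπ : ∀ x, π (ιS x) = ιG x) (hS : Generates ιS)
    (hG : IsGreatestGroupImage π) : Function.Surjective (toClosureMonoid hπ hS hG) := by
  intro a
  obtain ⟨F, hF, hFa⟩ := a.compact
  obtain ⟨t, ht, ht'⟩ := exists_term_span (closure_range_eq_top hπ hS hG) hF a.elt
  refine ⟨t.val ιS, ClosureMonoid.ext ?_ ((map_val π hπ t).trans ht')⟩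
  change FSch ιS ιG π hπ (t.val ιS) = a.graph
  rw [FSch_val, FSchTerm, ht, ← ClosureOperator.closure_sup_closure_left, ← hFa, sup_eq_left.2
    (sup_le (Subgr.vert_le_iff.2 a.one_mem) (Subgr.vert_le_iff.2 a.elt_mem)), a.closure_graph]

/-- The isomorphism `s ↦ (FΓ(s), sσ)`. -/
noncomputable def closureMonoidEquiv (hπ : ∀ x, π (ιS x) = ιG x) (hS : Generates ιS)
    (hG : IsGreatestGroupImage π) : S ≃* ClosureMonoid (closureOf ιS ιG π hπ) where
  __ := Equiv.ofBijective (toClosureMonoid hπ hS hG)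
    ⟨toClosureMonoid_injective hπ hS hG, toClosureMonoid_surjective hπ hS hG⟩
  map_mul' := toClosureMonoid_mul hπ hS hG

theorem map_inv_of_map_mul {S : Type v} {T : Type w} [InverseMonoid S] [InverseMonoid T]
    {f : S → T} (hf : ∀ a b, f (a * b) = f a * f b) (a : S) : f a⁻¹ = (f a)⁻¹ := by
  refine InverseMonoid.inv_unique _ _ ?_ ?_
  · rw [← hf, ← hf, InverseMonoid.mul_inv_mul]
  · rw [← hf, ← hf, InverseMonoid.inv_mul_inv]

theorem toClosureMonoid_gen (hπ : ∀ x, π (ιS x) = ιG x) (hS : Generates ιS)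
    (hG : IsGreatestGroupImage π) (x : X) :
    toClosureMonoid hπ hS hG (ιS x) = ClosureMonoid.gen (closureOf ιS ιG π hπ) x := by
  refine ClosureMonoid.ext ?_ (hπ x)
  have h : (FTerm.word [(x, true)]).val ιS = ιS x := by simp [FTerm.val, wordVal, letter]
  change FSch ιS ιG π hπ (ιS x) = _
  rw [← h, FSch_val]
  rfl

end SchuetzenbergerGraphs

/-! ### The monoid of a closure operator -/

namespace ClosureMonoid

variable {X : Type u} {G : Type w} [Group G] {ι : X → G} {c : InvClosure ι}

theorem letter_gen_graph (a : X × Bool) :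
    (letter (gen c) a).graph = c (Subgr.edge ι (1, a)) := by
  obtain ⟨x, b⟩ := a
  cases b
  · change (ι x)⁻¹ • c (pathSpan ι 1 [(x, true)]) = _
    rw [← c.map_smul, smul_pathSpan, mul_one, pathSpan_singleton, ← Subgr.edge_rev]
    simp [Edge.rev, Edge.tgt, letter]
  · change c (pathSpan ι 1 [(x, true)]) = _
    rw [pathSpan_singleton]

theorem wordVal_gen_elt (p : Word X) : (wordVal (gen c) p).elt = wordVal ι p :=
  map_wordVal (proj c) (fun _ => rfl) p

theorem val_gen_elt (t : FTerm X) : (t.val (gen c)).elt = t.groupVal ι :=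
  map_val (proj c) (fun _ => rfl) t

theorem wordVal_gen_graph (p : Word X) : (wordVal (gen c) p).graph = c (pathSpan ι 1 p) := by
  induction p with
  | nil => rfl
  | cons a p ih =>
    have h : (letter (gen c) a).elt = letter ι a := map_letter (π := proj c) (fun _ => rfl) a
    rw [wordVal, graph_mul, letter_gen_graph, ih, h, ← c.map_smul,
      ClosureOperator.closure_sup_closure, smul_pathSpan, mul_one, pathSpan, one_mul]

theorem val_gen_graph (t : FTerm X) : (t.val (gen c)).graph = c (journeySpan ι 1 t) := by
  induction t with
  | word a => exact wordVal_gen_graph a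
  | jump a b t ih =>
    have h : (FInverseMonoid.mx (wordVal (gen c) b)).graph =
        c (Subgr.vert ι 1 ⊔ Subgr.vert ι (wordVal ι b)) := by
      rw [← wordVal_gen_elt (c := c)]
      rfl
    have h' : (FInverseMonoid.mx (wordVal (gen c) b)).elt = wordVal ι b := wordVal_gen_elt b
    -- The two vertices contributed by `v^𝔪` are redundant: one is the end of the path before the
    -- jump, the other the start of the journey after it.
    rw [FTerm.val, graph_mul, graph_mul, elt_mul, h, h', ih, wordVal_gen_graph, wordVal_gen_elt,
      ← c.map_smul, ← c.map_smul, ClosureOperator.closure_sup_closure,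
      sup_assoc, ClosureOperator.closure_sup_closure_left, sup_left_comm,
      ClosureOperator.closure_sup_closure_left, sup_left_comm, ← sup_assoc, smul_journeySpan, Subgr.smul_sup, Subgr.smul_vert,
      Subgr.smul_vert, mul_one, mul_one, journeySpan, one_mul, ← sup_assoc,
      sup_assoc, sup_eq_right.2 (Subgr.vert_le_iff.2 (journeySpan_start_mem _ t)),
      sup_eq_left.2 (Subgr.vert_le_iff.2 (by simpa using pathSpan_finish_mem (ι := ι) a 1))]

theorem exists_val_gen_eq (hι : Subgroup.closure (Set.range ι) = ⊤) (a : ClosureMonoid c) :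
    ∃ t : FTerm X, t.val (gen c) = a := by
  obtain ⟨F, hF, hFa⟩ := a.compact
  obtain ⟨t, ht, ht'⟩ := exists_term_span hι hF a.elt
  refine ⟨t, ClosureMonoid.ext ?_ ((val_gen_elt t).trans ht')⟩
  rw [val_gen_graph, ht, ← ClosureOperator.closure_sup_closure_left, ← hFa, sup_eq_left.2
    (sup_le (Subgr.vert_le_iff.2 a.one_mem) (Subgr.vert_le_iff.2 a.elt_mem)), a.closure_graph]

theorem generates_gen (hι : Subgroup.closure (Set.range ι) = ⊤) : Generates (gen c) := by
  intro T hX h1 hmul hinv hmx a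
  have hw : ∀ p : Word X, wordVal (gen c) p ∈ T := by
    intro p
    induction p with
    | nil => exact h1
    | cons a p ih =>
      refine hmul _ ?_ _ ih
      obtain ⟨x, b⟩ := a
      cases b
      exacts [hinv _ (hX x), hX x]
  obtain ⟨t, rfl⟩ := exists_val_gen_eq hι a
  induction t with
  | word p => exact hw p
  | jump p q t ih => exact hmul _ (hmul _ (hw p) _ (hmx _ (hw q))) _ ih

theorem isGreatestGroupImage_proj (c : InvClosure ι) : IsGreatestGroupImage (proj c) := by
  refine ⟨fun g => ⟨top c g, rfl⟩, fun a b => ⟨fun h => ?_, elt_eq_of_sigma⟩⟩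
  change a.elt = b.elt at h
  -- The common lower bound is `a a⁻¹ b`, whose graph contains both graphs.
  have hle : a.graph ⊔ b.graph ≤ (a * a⁻¹ * b).graph := by
    rw [graph_mul, graph_mul_inv, elt_mul_inv, one_smul]
    exact ClosureOperator.le_closure _ _
  have he : (a * a⁻¹ * b).elt = b.elt := by rw [elt_mul, elt_mul_inv, one_mul]
  exact ⟨a * a⁻¹ * b, natLE_iff.2 ⟨he.trans h.symm, le_sup_left.trans hle⟩,
    natLE_iff.2 ⟨he, le_sup_right.trans hle⟩⟩

/-! ### Recovering `c` from `S_c` -/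

/-- Terms equal in `S_c` have spans with the same `c`-closure, also after translation, so a
`c`-closed subgraph contains both journeys or neither. Finitarity plays no role. -/
theorem closure_le (c : InvClosure ι) (Δ : Subgr ι) : closure c Δ ≤ c Δ := by
  refine ClosureOperator.closure_min (ClosureOperator.le_closure _ _)
    ((closureOf_isClosed_iff _).2 ?_)
  have key : ∀ t t' : FTerm X, t.val (gen c) = t'.val (gen c) → ∀ g h : G,
      Labels ι (c Δ) t g h → Labels ι (c Δ) t' g h := by
    rintro t t' htt g h ⟨h1, h2⟩
    refine ⟨?_, by rw [← h2, ← val_gen_elt (c := c), ← val_gen_elt (c := c), htt]⟩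
    have hg : c (journeySpan ι 1 t) = c (journeySpan ι 1 t') := by
      rw [← val_gen_graph, ← val_gen_graph, htt]
    calc journeySpan ι g t' ≤ c (journeySpan ι g t') := ClosureOperator.le_closure _ _
      _ = c (journeySpan ι g t) := by
        rw [← mul_one g, ← smul_journeySpan, ← smul_journeySpan, c.map_smul, c.map_smul, hg]
      _ ≤ c Δ := by simpa using c.monotone h1
  exact fun t t' htt g _ h _ => ⟨key t t' htt g h, key t' t htt.symm g h⟩

theorem le_closure_of_finite (hι : Subgroup.closure (Set.range ι) = ⊤) {F : Subgr ι}
    (hF : F.IsFinite) {g : G} (hg : g ∈ F.verts) : c F ≤ closure c F := by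
  set Δ := closure c F with hΔ
  have hcl : RelClosed (fun t t' => t.val (gen c) = t'.val (gen c)) Δ :=
    (closureOf_isClosed_iff (π := proj c) fun _ => rfl).1 (ClosureOperator.isClosed_closure _ _)
  have hFΔ : F ≤ Δ := ClosureOperator.le_closure _ _
  have hgΔ : g ∈ Δ.verts := hFΔ.1 hg
  -- Values in `S_c` record journeys from `1`, so `F` is translated to move `g` to `1`.
  have h1 : 1 ∈ (g⁻¹ • F).verts := by rwa [Subgr.mem_verts_smul, inv_inv, mul_one]
  obtain ⟨t, ht, ht'⟩ := exists_loop_span hι (hF.smul g⁻¹)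
  rw [sup_eq_right.2 (Subgr.vert_le_iff.2 h1)] at ht
  have hspan : ∀ E : Subgr ι, E.IsFinite → E ≤ c F → E ≤ Δ := by
    intro E hE hEF
    obtain ⟨s, hs, hs'⟩ := exists_loop_span hι (hE.smul g⁻¹)
    -- The loop `t` spans `g⁻¹ F` and `s` passes through `g⁻¹ E`, which lies in the `c`-closure of
    -- `g⁻¹ F`; the detour `s` is thus invisible in `S_c`.
    have hval : t.val (gen c) = (t.append s).val (gen c) := by
      refine ClosureMonoid.ext ?_ ?_
      · rw [val_gen_graph, val_gen_graph, journeySpan_append, ht, ht', one_mul, hs]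
        refine le_antisymm (c.monotone le_sup_left) (ClosureOperator.closure_min
          (sup_le (ClosureOperator.le_closure _ _) (sup_le ?_ ?_))
          (ClosureOperator.isClosed_closure _ _))
        · exact (Subgr.vert_le_iff.2 h1).trans (ClosureOperator.le_closure _ _)
        · rw [c.map_smul]
          exact Subgr.smul_mono _ hEF
      · rw [val_gen_elt, val_gen_elt, FTerm.groupVal_append, ht', hs', one_mul]
    have hlab := (hcl t _ hval g hgΔ g hgΔ).1 ⟨by
      rw [← mul_one g, ← smul_journeySpan, ht, smul_inv_smul]
      exact hFΔ, by rw [ht', mul_one]⟩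
    have := hlab.1
    rw [journeySpan_append, ht', mul_one] at this
    have h' := le_sup_right.trans this
    rw [← mul_one g, ← smul_journeySpan, hs, Subgr.smul_sup, smul_inv_smul] at h'
    exact le_sup_right.trans h'
  refine show _ ∧ _ from ⟨fun k hk => ?_, fun e he => ?_⟩
  · exact Subgr.vert_le_iff.1 (hspan _ (Subgr.vert_finite k) (Subgr.vert_le_iff.2 hk))
  · exact Subgr.edge_le_iff.1 (hspan _ (Subgr.edge_finite e) (Subgr.edge_le_iff.2 he))

theorem closure_eq (hι : Subgroup.closure (Set.range ι) = ⊤) (hc : c.Finitary) {Δ : Subgr ι}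
    (hΔ : Δ ≠ ⊥) : c Δ = closure c Δ := by
  refine le_antisymm ?_ (closure_le c Δ)
  obtain ⟨g, hg⟩ : Δ.verts.Nonempty := by
    by_contra hne
    rw [Set.not_nonempty_iff_eq_empty] at hne
    refine hΔ (Subgr.ext hne (Set.eq_empty_iff_forall_notMem.2 fun e he => ?_))
    have := Δ.src_mem e he
    rw [hne] at this
    exact this
  rw [hc Δ]
  refine sSup_le fun E hE => ?_
  obtain ⟨F, hF, hfin, rfl⟩ := hE
  -- A finite `F ⊆ Δ` may be empty, so a vertex of `Δ` is adjoined to provide a base point.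
  calc c F ≤ c (F ⊔ Subgr.vert ι g) := c.monotone le_sup_left
    _ ≤ closure c (F ⊔ Subgr.vert ι g) :=
      le_closure_of_finite hι (hfin.sup (Subgr.vert_finite g)) (Or.inr rfl)
    _ ≤ closure c Δ := (closure c).monotone (sup_le hF (Subgr.vert_le_iff.2 hg))

end ClosureMonoid

end FInv

open FInv

theorem mainTheorem2 {X : Type u} :
    (∀ (S : Type v) [FInverseMonoid S] (G : Type w) [Group G] (ιS : X → S) (ιG : X → G)
        (π : S →* G) (hπ : ∀ x, π (ιS x) = ιG x),
        Generates ιS → IsGreatestGroupImage π →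
        (∀ t : FTerm X, FSch ιS ιG π hπ (t.val ιS) = FSchTerm ιS ιG π hπ t) ∧
        ∃ ψ : S ≃* ClosureMonoid (closureOf ιS ιG π hπ),
          (∀ s, (ψ s).graph = FSch ιS ιG π hπ s ∧ (ψ s).elt = π s) ∧
          (∀ s, ψ s⁻¹ = (ψ s)⁻¹) ∧
          (∀ s, ψ (FInverseMonoid.mx s) = FInverseMonoid.mx (ψ s)) ∧
          (∀ x, ψ (ιS x) = ClosureMonoid.gen (closureOf ιS ιG π hπ) x)) ∧
    (∀ (G : Type w) [Group G] (ι : X → G), Subgroup.closure (Set.range ι) = ⊤ →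
        ∀ c : InvClosure ι, c.Finitary →
          Generates (ClosureMonoid.gen c) ∧ IsGreatestGroupImage (ClosureMonoid.proj c) ∧
          (∀ Δ : Subgr ι, Δ ≠ ⊥ → c Δ = ClosureMonoid.closure c Δ) ∧
          (c ⊥ = ⊥ →
            c.toClosureOperator = (ClosureMonoid.closure c).toClosureOperator)) := by
  refine ⟨fun S _ G _ ιS ιG π hπ hS hG => ⟨FSch_val hπ, closureMonoidEquiv hπ hS hG,
    fun s => ⟨rfl, rfl⟩, map_inv_of_map_mul (map_mul _), toClosureMonoid_mx hπ hS hG,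
    toClosureMonoid_gen hπ hS hG⟩, fun G _ ι hι c hc => ⟨ClosureMonoid.generates_gen hι,
    ClosureMonoid.isGreatestGroupImage_proj c, fun Δ => ClosureMonoid.closure_eq hι hc,
    fun hbot => ClosureOperator.ext _ _ fun Δ => ?_⟩⟩
  by_cases hΔ : Δ = ⊥
  · rw [hΔ]
    -- The closure `c_{S_c}` lies below `c`, so it fixes `∅` when `c` does.
    exact hbot.trans (le_bot_iff.1 ((ClosureMonoid.closure_le c ⊥).trans hbot.le)).symm
  · exact ClosureMonoid.closure_eq hι hc hΔ
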